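/- Let $m=(m_{jk})\in SL(3,\mathbb Z)$ have an irrational real eigenvalue $c>1$ and two non-real complex conjugate eigenvalues $\alpha,\bar\alpha$ with $|\alpha|^2c=1$; let $(c_1,c_2,c_3)\in\mathbb R^3$ and $(\alpha_1,\alpha_2,\alpha_3)\in\mathbb C^3$ be (non-zero) eigenvectors of $m$ for $c$ and $\alpha$. Let $S^6$ be the Lie group $\mathbb R\times\mathbb R\times\mathbb C\times\mathbb C$ with product $$(t,u,z,w)*(t',u',z',w')=(t+t',\,c^tu'+u,\,\alpha^tz'+z,\,e^{i\frac\pi2t}w'+w),$$ where $\alpha^t=e^{t\operatorname{Log}\alpha}$ with the principal logarithm. Let $\Gamma\subset S^6$ be the subgroup generated by $g_0=(1,0,0,0)$, $g_j=(0,c_j,\alpha_j,0)$ ($j=1,2,3$), $g_4=(0,0,0,1)$, $g_5=(0,0,0,i)$; that is, $\Gamma$ acts on $S^6$ by left translations and is generated by $g_0:(t,u,z,w)\mapsto(t+1,cu,\alpha z,iw)$, $g_j:(t,u,z,w)\mapsto(t,u+c_j,z+\alpha_j,w)$, $g_4:(t,u,z,w)\mapsto(t,u,z,w+1)$ and $g_5:(t,u,z,w)\mapsto(t,u,z,w+i)$.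 Let $M^6=\Gamma\backslash S^6$. Let $S^4=\mathbb R\times\mathbb R\times\mathbb C$ be the group obtained from $S^6$ by omitting the coordinate $w$, let $\Gamma_1\subset S^4$ be generated by the images of $g_0,g_1,g_2,g_3$, and let $M^4=\Gamma_1\backslash S^4$. Let $S^0=(\mathcal H\times\mathbb C)/G_M$ be the Inoue surface, where $\mathcal H$ is the upper half-plane and $G_M$ is generated by $(\zeta,z)\mapsto(c\zeta,\alpha z)$ and $(\zeta,z)\mapsto(\zeta+c_j,z+\alpha_j)$, $j=1,2,3$. Proposition 3.2. $M^6$, $M^4$ and $S^0$, with the smooth structures for which the quotient maps from $\mathbb R\times\mathbb R\times\mathbb C\times\mathbb C$, $\mathbb R\times\mathbb R\times\mathbb C$ and $\mathcal H\times\mathbb C$ are local diffeomorphisms, are compact Hausdorff smooth manifolds; the map $(t,u,z)\mapsto(u+ic^t,z)$ induces a diffeomorphism $M^4\cong S^0$; and the map $M^6\to M^4\cong S^0$ induced by $(t,u,z,w)\mapsto(t,u,z)$ is a smooth (locally trivial) fibre bundle with fibre the torus $\mathbb T^2=S^1\times S^1$. The first Betti number $b_1(M^6)=\dim_{\mathbb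 Q}H_1(M^6;\mathbb Q)$ is $1$. Moreover the abelianization of $\Gamma$ has rank $1$, and in $\Gamma$, with $[x,y]=xyx^{-1}y^{-1}$, one has $[g_0,g_4]=g_4^{-1}g_5$ and $[g_0,g_5]=g_4^{-1}g_5^{-1}$. -/

import Mathlib

open scoped Manifold ContDiff UpperHalfPlane commutatorElement

/-- The data from which an Inoue surface of type `S⁰` is built: a matrix `m ∈ SL(3, ℤ)` with an
irrational real eigenvalue `c > 1` and a pair of complex conjugate (non-real) eigenvalues `α, ᾱ`,
with `|α|² c = 1`, together with a real eigenvector `(c₁, c₂, c₃)` for `c` and an eigenvector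
`(α₁, α₂, α₃)` for `α`. -/
structure InoueData where
  m : Matrix.SpecialLinearGroup (Fin 3) ℤ
  c : ℝ
  α : ℂ
  one_lt_c : 1 < c
  irrational_c : Irrational c
  α_im_ne_zero : α.im ≠ 0
  norm_α_sq_mul_c : ‖α‖ ^ 2 * c = 1
  cvec : Fin 3 → ℝ
  αvec : Fin 3 → ℂ
  cvec_ne_zero : cvec ≠ 0
  αvec_ne_zero : αvec ≠ 0
  mulVec_cvec : ((m : Matrix (Fin 3) (Fin 3) ℤ).map (Int.cast : ℤ → ℝ)).mulVec cvec = c • cvec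
  mulVec_αvec : ((m : Matrix (Fin 3) (Fin 3) ℤ).map (Int.cast : ℤ → ℂ)).mulVec αvec = α • αvec

theorem InoueData.c_pos (D : InoueData) : 0 < D.c := zero_lt_one.trans D.one_lt_c

theorem InoueData.α_ne_zero (D : InoueData) : D.α ≠ 0 := fun h =>
  D.α_im_ne_zero (by rw [h]; rfl)

noncomputable section

/-! ### The four-dimensional solvable group and its lattice -/

/-- The four-dimensional solvable Lie group, on `ℝ × (ℝ × ℂ)` with coordinates `(t, u, z)`. -/
@[ext]
structure Sol4 (D : InoueData) where
  t : ℝ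
  u : ℝ
  z : ℂ

/-- The global coordinates on the four-dimensional group. -/
def Sol4.coords (D : InoueData) : Sol4 D ≃ ℝ × ℝ × ℂ where
  toFun p := (p.t, p.u, p.z)
  invFun x := ⟨x.1, x.2.1, x.2.2⟩
  left_inv _ := rfl
  right_inv _ := rfl

instance (D : InoueData) : TopologicalSpace (Sol4 D) :=
  TopologicalSpace.induced (Sol4.coords D) inferInstance

/-- `(t, u, z) · (t', u', z') = (t + t', c ^ t u' + u, α ^ t z' + z)`. -/
instance (D : InoueData) : Mul (Sol4 D) where
  mul p q := ⟨p.t + q.t, D.c ^ p.t * q.u + p.u, D.α ^ (p.t : ℂ) * q.z + p.z⟩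

instance (D : InoueData) : One (Sol4 D) where
  one := ⟨0, 0, 0⟩

instance (D : InoueData) : Inv (Sol4 D) where
  inv p := ⟨-p.t, -(D.c ^ (-p.t) * p.u), -(D.α ^ (-(p.t : ℂ)) * p.z)⟩

theorem Sol4.mul_def {D : InoueData} (p q : Sol4 D) : p * q =
    ⟨p.t + q.t, D.c ^ p.t * q.u + p.u, D.α ^ (p.t : ℂ) * q.z + p.z⟩ := rfl

theorem Sol4.one_def {D : InoueData} : (1 : Sol4 D) = ⟨0, 0, 0⟩ := rfl

theorem Sol4.inv_def {D : InoueData} (p : Sol4 D) : p⁻¹ =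
    ⟨-p.t, -(D.c ^ (-p.t) * p.u), -(D.α ^ (-(p.t : ℂ)) * p.z)⟩ := rfl

instance (D : InoueData) : Group (Sol4 D) where
  mul_assoc p q r := by
    simp only [Sol4.mul_def, Real.rpow_add D.c_pos, Complex.ofReal_add,
      Complex.cpow_add _ _ D.α_ne_zero]
    refine Sol4.ext ?_ ?_ ?_ <;> simp only <;> ring
  one_mul p := by simp [Sol4.mul_def, Sol4.one_def]
  mul_one p := by simp [Sol4.mul_def, Sol4.one_def]
  inv_mul_cancel p := by simp [Sol4.mul_def, Sol4.one_def, Sol4.inv_def]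

/-- The generator `h₀ : (t, u, z) ↦ (t + 1, c u, α z)` (as a left translation). -/
def h0 (D : InoueData) : Sol4 D := ⟨1, 0, 0⟩

/-- The generators `h_j : (t, u, z) ↦ (t, u + c_j, z + α_j)`, `j = 1, 2, 3` (as left
translations). -/
def hTrans (D : InoueData) (j : Fin 3) : Sol4 D := ⟨0, D.cvec j, D.αvec j⟩

/-- The lattice `Γ₁` generated by `h₀, h₁, h₂, h₃`. -/
def Gamma4 (D : InoueData) : Subgroup (Sol4 D) :=
  Subgroup.closure ({h0 D} ∪ Set.range (hTrans D))

/-- The four-dimensional solvmanifold `M⁴`: the space of orbits of the lattice `Γ₁` acting by left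
translations. -/
def M4 (D : InoueData) : Type := Quotient (MulAction.orbitRel (Gamma4 D) (Sol4 D))

instance (D : InoueData) : TopologicalSpace (M4 D) :=
  inferInstanceAs (TopologicalSpace (Quotient (MulAction.orbitRel (Gamma4 D) (Sol4 D))))

def M4.mk (D : InoueData) : Sol4 D → M4 D := Quotient.mk _

/-- The quotient map `ℝ × ℝ × ℂ → M⁴` in the coordinates `(t, u, z)`. -/
def M4.proj (D : InoueData) : ℝ × ℝ × ℂ → M4 D := fun x => M4.mk D ((Sol4.coords D).symm x)

/-! ### The six-dimensional solvable group and its lattice -/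

/-- `e ^ (i (π/2) t)`. -/
def quarterRotation (t : ℝ) : ℂ := Complex.exp (Complex.I * (Real.pi / 2) * t)

theorem quarterRotation_add (s t : ℝ) :
    quarterRotation (s + t) = quarterRotation s * quarterRotation t := by
  simp only [quarterRotation, Complex.ofReal_add, mul_add, Complex.exp_add]

theorem quarterRotation_zero : quarterRotation 0 = 1 := by
  simp [quarterRotation]

/-- The six-dimensional solvable Lie group, on `ℝ × (ℝ × ℂ × ℂ)` with coordinates
`(t, u, z, w)`. -/
@[ext]
structure Sol6 (D : InoueData) where
  t : ℝ
  u : ℝ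
  z : ℂ
  w : ℂ

/-- The global coordinates on the six-dimensional group. -/
def Sol6.coords (D : InoueData) : Sol6 D ≃ ℝ × ℝ × ℂ × ℂ where
  toFun p := (p.t, p.u, p.z, p.w)
  invFun x := ⟨x.1, x.2.1, x.2.2.1, x.2.2.2⟩
  left_inv _ := rfl
  right_inv _ := rfl

instance (D : InoueData) : TopologicalSpace (Sol6 D) :=
  TopologicalSpace.induced (Sol6.coords D) inferInstance

/-- `(t, u, z, w) * (t', u', z', w')
  = (t + t', c ^ t u' + u, α ^ t z' + z, e ^ (i (π/2) t) w' + w)`. -/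
instance (D : InoueData) : Mul (Sol6 D) where
  mul p q := ⟨p.t + q.t, D.c ^ p.t * q.u + p.u, D.α ^ (p.t : ℂ) * q.z + p.z,
    quarterRotation p.t * q.w + p.w⟩

instance (D : InoueData) : One (Sol6 D) where
  one := ⟨0, 0, 0, 0⟩

instance (D : InoueData) : Inv (Sol6 D) where
  inv p := ⟨-p.t, -(D.c ^ (-p.t) * p.u), -(D.α ^ (-(p.t : ℂ)) * p.z),
    -(quarterRotation (-p.t) * p.w)⟩

theorem Sol6.mul_def {D : InoueData} (p q : Sol6 D) : p * q =
    ⟨p.t + q.t, D.c ^ p.t * q.u + p.u, D.α ^ (p.t : ℂ) * q.z + p.z,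
      quarterRotation p.t * q.w + p.w⟩ := rfl

theorem Sol6.one_def {D : InoueData} : (1 : Sol6 D) = ⟨0, 0, 0, 0⟩ := rfl

theorem Sol6.inv_def {D : InoueData} (p : Sol6 D) : p⁻¹ =
    ⟨-p.t, -(D.c ^ (-p.t) * p.u), -(D.α ^ (-(p.t : ℂ)) * p.z),
      -(quarterRotation (-p.t) * p.w)⟩ := rfl

instance (D : InoueData) : Group (Sol6 D) where
  mul_assoc p q r := by
    simp only [Sol6.mul_def, Real.rpow_add D.c_pos, Complex.ofReal_add,
      Complex.cpow_add _ _ D.α_ne_zero, quarterRotation_add]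
    refine Sol6.ext ?_ ?_ ?_ ?_ <;> simp only <;> ring
  one_mul p := by simp [Sol6.mul_def, Sol6.one_def, quarterRotation_zero]
  mul_one p := by simp [Sol6.mul_def, Sol6.one_def]
  inv_mul_cancel p := by simp [Sol6.mul_def, Sol6.one_def, Sol6.inv_def]

/-- The generator `g₀ : (t, u, z, w) ↦ (t + 1, c u, α z, i w)` (as a left translation). -/
def g0 (D : InoueData) : Sol6 D := ⟨1, 0, 0, 0⟩

/-- The generators `g_j : (t, u, z, w) ↦ (t, u + c_j, z + α_j, w)`, `j = 1, 2, 3` (as left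
translations). -/
def gTrans (D : InoueData) (j : Fin 3) : Sol6 D :=
  ⟨0, D.cvec j, D.αvec j, 0⟩

/-- The generator `g₄ : (t, u, z, w) ↦ (t, u, z, w + 1)` (as a left translation). -/
def g4 (D : InoueData) : Sol6 D := ⟨0, 0, 0, 1⟩

/-- The generator `g₅ : (t, u, z, w) ↦ (t, u, z, w + i)` (as a left translation). -/
def g5 (D : InoueData) : Sol6 D := ⟨0, 0, 0, Complex.I⟩

/-- The lattice `Γ` generated by `g₀, …, g₅`. -/
def Gamma6 (D : InoueData) : Subgroup (Sol6 D) :=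
  Subgroup.closure ({g0 D} ∪ Set.range (gTrans D) ∪ {g4 D, g5 D})

/-- The six-dimensional solvmanifold `M⁶`: the space of orbits of the lattice `Γ` acting by left
translations. -/
def M6 (D : InoueData) : Type := Quotient (MulAction.orbitRel (Gamma6 D) (Sol6 D))

instance (D : InoueData) : TopologicalSpace (M6 D) :=
  inferInstanceAs (TopologicalSpace (Quotient (MulAction.orbitRel (Gamma6 D) (Sol6 D))))

def M6.mk (D : InoueData) : Sol6 D → M6 D := Quotient.mk _

/-- The quotient map `ℝ × ℝ × ℂ × ℂ → M⁶` in the coordinates `(t, u, z, w)`. -/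
def M6.proj (D : InoueData) : ℝ × ℝ × ℂ × ℂ → M6 D := fun x => M6.mk D ((Sol6.coords D).symm x)

/-! ### The projection -/

/-- The homomorphism `(t, u, z, w) ↦ (t, u, z)`. -/
def forgetHom (D : InoueData) : Sol6 D →* Sol4 D where
  toFun p := ⟨p.t, p.u, p.z⟩
  map_one' := rfl
  map_mul' _ _ := rfl

theorem forgetHom_mem (D : InoueData) {g : Sol6 D} (hg : g ∈ Gamma6 D) :
    forgetHom D g ∈ Gamma4 D := by
  have h : Gamma6 D ≤ (Gamma4 D).comap (forgetHom D) := by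
    refine (Subgroup.closure_le _).2 ?_
    rintro x ((hx | ⟨j, rfl⟩) | hx | hx)
    · rw [Set.mem_singleton_iff.1 hx]
      exact Subgroup.subset_closure (Or.inl rfl)
    · exact Subgroup.subset_closure (Or.inr ⟨j, rfl⟩)
    · rw [hx]; exact (Gamma4 D).one_mem
    · rw [Set.mem_singleton_iff.1 hx]; exact (Gamma4 D).one_mem
  exact h hg

/-- The map `M⁶ → M⁴` induced by `(t, u, z, w) ↦ (t, u, z)`. -/
def forgetW (D : InoueData) : M6 D → M4 D :=
  Quotient.map (forgetHom D) (by
    rintro _ b ⟨γ, rfl⟩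
    exact ⟨⟨forgetHom D γ, forgetHom_mem D γ.2⟩, ((forgetHom D).map_mul γ b).symm⟩)

/-! ### The Inoue surface `S⁰ = (ℍ × ℂ) / G_M` -/

/-- The automorphism `(ζ, z) ↦ (c ζ, α z)` of `ℍ × ℂ`. -/
def inoueScale (D : InoueData) : Equiv.Perm (ℍ × ℂ) :=
  Equiv.prodCongr (MulAction.toPerm (⟨D.c, D.c_pos⟩ : {x : ℝ // 0 < x}))
    (MulAction.toPerm (Units.mk0 D.α D.α_ne_zero))

/-- The automorphisms `(ζ, z) ↦ (ζ + c_j, z + α_j)` of `ℍ × ℂ`, `j = 1, 2, 3`. -/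
def inoueTrans (D : InoueData) (j : Fin 3) : Equiv.Perm (ℍ × ℂ) :=
  Equiv.prodCongr (AddAction.toPerm (D.cvec j)) (Equiv.addRight (D.αvec j))

/-- The group `G_M` of automorphisms of `ℍ × ℂ` defining the Inoue surface. -/
def inoueGroup (D : InoueData) : Subgroup (Equiv.Perm (ℍ × ℂ)) :=
  Subgroup.closure ({inoueScale D} ∪ Set.range (inoueTrans D))

/-- The Inoue surface `S⁰ = (ℍ × ℂ) / G_M`. -/
def InoueSurface (D : InoueData) : Type := Quotient (MulAction.orbitRel (inoueGroup D) (ℍ × ℂ))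

instance (D : InoueData) : TopologicalSpace (InoueSurface D) :=
  inferInstanceAs (TopologicalSpace (Quotient (MulAction.orbitRel (inoueGroup D) (ℍ × ℂ))))

def InoueSurface.mk (D : InoueData) : ℍ × ℂ → InoueSurface D := Quotient.mk _

/-- The map `(t, u, z) ↦ (u + i c ^ t, z)` from the solvable group to `ℍ × ℂ`. -/
def sol4ToUpperHalf (D : InoueData) (p : Sol4 D) : ℍ × ℂ :=
  (⟨⟨p.u, D.c ^ p.t⟩, Real.rpow_pos_of_pos D.c_pos p.t⟩, p.z)

/-! ### Smooth fibre bundles and the first Betti number -/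

/-- `π : E → B` is a smooth fibre bundle with fibre `F`: around each point of `B` there is a local
trivialization `π⁻¹(U) ≃ U × F` over `U` that is smooth with smooth inverse. -/
def IsSmoothFiberBundle
    {VE HE VB HB VF HF : Type*}
    [NormedAddCommGroup VE] [NormedSpace ℝ VE] [TopologicalSpace HE]
    [NormedAddCommGroup VB] [NormedSpace ℝ VB] [TopologicalSpace HB]
    [NormedAddCommGroup VF] [NormedSpace ℝ VF] [TopologicalSpace HF]
    (IE : ModelWithCorners ℝ VE HE) (IB : ModelWithCorners ℝ VB HB) (IF : ModelWithCorners ℝ VF HF)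
    {E B : Type*} (F : Type*)
    [TopologicalSpace E] [ChartedSpace HE E] [TopologicalSpace B] [ChartedSpace HB B]
    [TopologicalSpace F] [ChartedSpace HF F] (π : E → B) : Prop :=
  ∀ b : B, ∃ e : Bundle.Trivialization F π, b ∈ e.baseSet ∧
    ContMDiffOn IE (IB.prod IF) ∞ e e.source ∧
    ContMDiffOn (IB.prod IF) IE ∞ e.toOpenPartialHomeomorph.symm e.target

/-- The first Betti number `dim H₁(X; ℚ)`, in singular homology. -/
def firstBettiNumber (X : Type) [TopologicalSpace X] : ℕ :=
  Module.finrank ℚ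
    (((AlgebraicTopology.singularHomologyFunctor (ModuleCat.{0} ℚ) 1).obj
      (ModuleCat.of ℚ ℚ)).obj (TopCat.of X))

end

/-! Everything rests on an explicit description of `Γ`. Multiplying by `(c, α)` sends the vector
`(c_j, α_j)` to the integral combination given by row `j` of `m`. Multiplication by `i` preserves
`ℤ[i]`. So every element of `Γ` has an integer time, a point of the lattice spanned by the `(c_j,
α_j)` and a Gaussian integer as its coordinates (`exists_of_mem_Gamma6`). Eigenvectors for the
distinct eigenvalues `c, α, ᾱ` are independent, so the `(c_j, α_j)` form a real basis of `ℝ × ℂ`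
(`latticeMap_injective`). In this basis `Γ` consists of integer points. It therefore meets compact
sets in finite sets, acts properly discontinuously, and has a compact cube surjecting onto the
quotient.

The quotient maps are thus coverings. Local inverses of a covering are charts of the base, and their
transitions are locally deck transformations, hence smooth. The map `(t, u, z) ↦ (u + i c ^ t, z)`
carries `Γ₁` onto `G_M`, which identifies `M⁴` with the Inoue surface. Over a local section of `ℝ ×
ℝ × ℂ → M⁴`, a point of `M⁶` is determined by `w` modulo `ℤ[i]`, which gives the torus bundle.

In the abelianization of `Γ` the two commutators give `2[g₄] = 0` and `[g₅] = [g₄]`, and conjugation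
by `g₀` gives `(m - 1)[g_j] = 0`. Since `1` is not an eigenvalue of `m`, only `[g₀]` survives up to
torsion (`abelianization_Gamma6`).

For `H₁` (`firstBettiNumber_eq_one_of_covering`), singular simplices lift to the coordinate space,
where straight-line homotopies replace every path by a segment. Modulo boundaries, segments from `0`
to its translates define a homomorphism on `Γ` with values in a rational vector space. Its image
generates all cycles, so the class of `g₀` spans them. That class is nonzero, because the increase
of `t` along a lifted path is a cocycle with value `1` on it. -/

/-! ### Rational singular one-chains modulo boundaries -/

section SingularOneChains

open CategoryTheory Simplicial SSet

/-- Balls meet a convex set in convex sets. Lifting simplices through coverings needs local path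
connectedness besides contractibility. -/
theorem Convex.locallyPathConnectedSpace_subtype {E : Type*} [NormedAddCommGroup E]
    [NormedSpace ℝ E] {s : Set E} (hs : Convex ℝ s) : LocallyPathConnectedSpace s := by
  refine LocallyPathConnectedSpace.of_bases
    (p := fun _ r => 0 < r) (s := fun x r => Metric.ball x r) (fun x => Metric.nhds_basis_ball) ?_
  intro x r hr
  have hc : Convex ℝ (s ∩ Metric.ball (x : E) r) := hs.inter (convex_ball _ _)
  have hp := hc.isPathConnected ⟨x, x.2, Metric.mem_ball_self hr⟩
  have : (Metric.ball x r : Set s) = (Subtype.val : s → E) ⁻¹' (s ∩ Metric.ball (x : E) r) := by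
    ext y; simp [Subtype.dist_eq]
  rw [this]
  exact Topology.IsInducing.subtypeVal.isPathConnected_iff.2 (by
    rwa [Subtype.image_preimage_coe, ← Set.inter_assoc, Set.inter_self])

/-- The standard topological simplex with vertices `0, …, n`. -/
abbrev TopSimplex (n : ℕ) := stdSimplex ℝ (Fin (n + 1))

instance (n : ℕ) : LocallyPathConnectedSpace (TopSimplex n) :=
  (convex_stdSimplex ℝ _).locallyPathConnectedSpace_subtype

instance (n : ℕ) : ContractibleSpace (TopSimplex n) :=
  (convex_stdSimplex ℝ _).contractibleSpace ⟨_, single_mem_stdSimplex ℝ 0⟩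

/-- The `i`-th face inclusion of standard topological simplices. -/
noncomputable def faceInclusion {n : ℕ} (i : Fin (n + 2)) : C(TopSimplex n, TopSimplex (n + 1)) :=
  ⟨stdSimplex.map i.succAbove, stdSimplex.continuous_map _⟩

theorem faceInclusion_apply_self {n : ℕ} (i : Fin (n + 2)) (x : TopSimplex n) :
    faceInclusion i x i = 0 := by
  simp [faceInclusion, FunOnFinite.linearMap_apply_apply, Fin.succAbove_ne]

theorem faceInclusion_apply_succAbove {n : ℕ} (i : Fin (n + 2)) (x : TopSimplex n)
    (j : Fin (n + 1)) : faceInclusion i x (i.succAbove j) = x j := by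
  simp [faceInclusion, FunOnFinite.linearMap_apply_apply, Finset.filter_eq']

theorem faceInclusion_vertex {n : ℕ} (i : Fin (n + 2)) (j : Fin (n + 1)) :
    faceInclusion i (stdSimplex.vertex j) = stdSimplex.vertex (i.succAbove j) :=
  stdSimplex.map_vertex _ _

variable {X : Type} [TopologicalSpace X]

/-- A singular simplex as an element of the singular simplicial set. -/
noncomputable def singularSimplex {n : ℕ} (f : C(TopSimplex n, X)) :
    (TopCat.toSSet.obj (TopCat.of X)) _⦋n⦌ :=
  ((TopCat.of X).toSSetObjEquiv (.op ⦋n⦌)).symm f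

theorem singularSimplex_surjective {n : ℕ} :
    Function.Surjective (singularSimplex (X := X) (n := n)) :=
  ((TopCat.of X).toSSetObjEquiv (.op ⦋n⦌)).symm.surjective

theorem δ_singularSimplex {n : ℕ} (f : C(TopSimplex (n + 1), X)) (i : Fin (n + 2)) :
    (TopCat.toSSet.obj (TopCat.of X)).δ i (singularSimplex f) =
      singularSimplex (f.comp (faceInclusion i)) := rfl

variable (X) in
/-- The rational singular chain complex. -/
noncomputable abbrev rationalChains : ChainComplex (ModuleCat.{0} ℚ) ℕ :=
  (TopCat.toSSet.obj (TopCat.of X)).chainComplex (ModuleCat.of ℚ ℚ)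

/-- A singular simplex as a rational chain. -/
noncomputable def simplexChain {n : ℕ} (f : C(TopSimplex n, X)) : (rationalChains X).X n :=
  (SSet.ιChainComplex (R := ModuleCat.of ℚ ℚ) _ (singularSimplex f)).hom (1 : ℚ)

theorem rationalChains_d_simplexChain {n : ℕ} (f : C(TopSimplex (n + 1), X)) :
    ((rationalChains X).d (n + 1) n).hom (simplexChain f) =
      ∑ i : Fin (n + 2), (-1 : ℤ) ^ (i : ℕ) • simplexChain (f.comp (faceInclusion i)) := by
  have h := SSet.ιChainComplex_d (TopCat.toSSet.obj (TopCat.of X)) (ModuleCat.of ℚ ℚ)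
    (singularSimplex f)
  have h' := congrArg (fun φ => φ.hom (1 : ℚ)) h
  simp only [ModuleCat.hom_comp, ModuleCat.hom_sum, LinearMap.comp_apply] at h'
  rw [simplexChain, h']
  simp [simplexChain, δ_singularSimplex]

/-- The chain group is the coproduct of copies of `ℚ` indexed by the singular simplices. -/
theorem rationalChains_hom_ext {n : ℕ} {V : Type} [AddCommGroup V] [Module ℚ V]
    {φ ψ : (rationalChains X).X n →ₗ[ℚ] V}
    (h : ∀ f : C(TopSimplex n, X), φ (simplexChain f) = ψ (simplexChain f)) : φ = ψ := by
  have : ModuleCat.ofHom φ = ModuleCat.ofHom ψ := by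
    refine SSet.chainComplex_hom_ext fun x => ?_
    obtain ⟨f, rfl⟩ := singularSimplex_surjective x
    refine ModuleCat.hom_ext (LinearMap.ext_ring ?_)
    exact h f
  exact congrArg ModuleCat.Hom.hom this

/-- The linear map on chains with prescribed values on singular simplices. -/
noncomputable def chainDesc {n : ℕ} {V : Type} [AddCommGroup V] [Module ℚ V]
    (v : C(TopSimplex n, X) → V) : (rationalChains X).X n →ₗ[ℚ] V :=
  ((SSet.isColimitChainComplexXCofan (TopCat.toSSet.obj (TopCat.of X)) (ModuleCat.of ℚ ℚ) n).desc
    (Limits.Cofan.mk (ModuleCat.of ℚ V) fun x => ModuleCat.ofHom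
      (LinearMap.toSpanSingleton ℚ V (v ((TopCat.of X).toSSetObjEquiv (.op ⦋n⦌) x))))).hom

theorem chainDesc_simplexChain {n : ℕ} {V : Type} [AddCommGroup V] [Module ℚ V]
    (v : C(TopSimplex n, X) → V) (f : C(TopSimplex n, X)) :
    chainDesc v (simplexChain f) = v f := by
  have h := (SSet.isColimitChainComplexXCofan (TopCat.toSSet.obj (TopCat.of X))
    (ModuleCat.of ℚ ℚ) n).fac
    (Limits.Cofan.mk (ModuleCat.of ℚ V) fun x => ModuleCat.ofHom
      (LinearMap.toSpanSingleton ℚ V (v ((TopCat.of X).toSSetObjEquiv (.op ⦋n⦌) x))))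
    ⟨singularSimplex f⟩
  have h' := congrArg (fun φ => φ.hom (1 : ℚ)) h
  refine Eq.trans h' ?_
  simp [singularSimplex]

variable (X) in
/-- One-chains modulo boundaries. -/
noncomputable abbrev oneChainsModBoundary : ModuleCat.{0} ℚ := (rationalChains X).opcycles 1

/-- The class of a singular one-simplex modulo boundaries. -/
noncomputable def simplexClass (f : C(TopSimplex 1, X)) : oneChainsModBoundary X :=
  ((rationalChains X).pOpcycles 1).hom (simplexChain f)

theorem simplexClass_boundary (f : C(TopSimplex 2, X)) :
    simplexClass (f.comp (faceInclusion 0)) - simplexClass (f.comp (faceInclusion 1)) +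
      simplexClass (f.comp (faceInclusion 2)) = 0 := by
  have h := congrArg (fun φ => φ.hom (simplexChain f))
    ((rationalChains X).d_pOpcycles 2 1)
  simp only [ModuleCat.hom_comp, LinearMap.comp_apply, rationalChains_d_simplexChain] at h
  simpa [Fin.sum_univ_three, simplexClass, sub_eq_add_neg] using h

/-- The boundary of one-chains modulo boundaries. -/
noncomputable def boundaryOfClass : oneChainsModBoundary X →ₗ[ℚ] (rationalChains X).X 0 :=
  ((rationalChains X).fromOpcycles 1 0).hom

theorem boundaryOfClass_simplexClass (f : C(TopSimplex 1, X)) :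
    boundaryOfClass (simplexClass f) =
      simplexChain (f.comp (faceInclusion 0)) - simplexChain (f.comp (faceInclusion 1)) := by
  have h := congrArg (fun φ => φ.hom (simplexChain f))
    ((rationalChains X).p_fromOpcycles 1 0)
  refine Eq.trans h ?_
  rw [rationalChains_d_simplexChain]
  simp [Fin.sum_univ_two, sub_eq_add_neg]

theorem oneChainsModBoundary_hom_ext {V : Type} [AddCommGroup V] [Module ℚ V]
    {φ ψ : oneChainsModBoundary X →ₗ[ℚ] V}
    (h : ∀ f : C(TopSimplex 1, X), φ (simplexClass f) = ψ (simplexClass f)) : φ = ψ := by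
  have h1 : φ ∘ₗ ((rationalChains X).pOpcycles 1).hom = ψ ∘ₗ ((rationalChains X).pOpcycles 1).hom :=
    rationalChains_hom_ext h
  have h2 : (rationalChains X).pOpcycles 1 ≫ ModuleCat.ofHom φ =
      (rationalChains X).pOpcycles 1 ≫ ModuleCat.ofHom ψ := ModuleCat.hom_ext h1
  exact congrArg ModuleCat.Hom.hom ((cancel_epi _).1 h2)

/-- The hypothesis is the cocycle condition, which is what lets the linear extension of `v` descend
to the quotient by boundaries. -/
theorem exists_functional_of_boundary {V : Type} [AddCommGroup V] [Module ℚ V]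
    (v : C(TopSimplex 1, X) → V)
    (hv : ∀ f : C(TopSimplex 2, X), v (f.comp (faceInclusion 0)) -
      v (f.comp (faceInclusion 1)) + v (f.comp (faceInclusion 2)) = 0) :
    ∃ φ : oneChainsModBoundary X →ₗ[ℚ] V, ∀ f, φ (simplexClass f) = v f := by
  have h0 : (rationalChains X).d 2 1 ≫ ModuleCat.ofHom (chainDesc v) = 0 := by
    refine ModuleCat.hom_ext (rationalChains_hom_ext fun f => ?_)
    change chainDesc v (((rationalChains X).d 2 1).hom (simplexChain f)) = 0
    rw [rationalChains_d_simplexChain]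
    simpa [Fin.sum_univ_three, chainDesc_simplexChain, sub_eq_add_neg] using hv f
  refine ⟨((rationalChains X).descOpcycles (ModuleCat.ofHom (chainDesc v)) 2 (by simp) h0).hom,
    fun f => ?_⟩
  have h := congrArg (fun φ => φ.hom (simplexChain f))
    ((rationalChains X).p_descOpcycles (ModuleCat.ofHom (chainDesc v)) 2 (by simp) h0)
  exact Eq.trans h (chainDesc_simplexChain v f)

/-- Taking the quotient by boundaries before the kernel also computes homology. This order allows
homologous simplices to be identified even when they are not cycles. -/
theorem firstBettiNumber_eq_finrank_ker :
    firstBettiNumber X =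
      Module.finrank ℚ (LinearMap.ker (boundaryOfClass (X := X))) := by
  have hk := (rationalChains X).homologyIsKernel 1 0 (by simp)
  let e := hk.conePointUniqueUpToIso
    (ModuleCat.kernelIsLimit ((rationalChains X).fromOpcycles 1 0))
  exact e.toLinearEquiv.finrank_eq

end SingularOneChains

/-! ### Lifting singular simplices through a covering -/

section LiftSimplex

variable {E X : Type*} [TopologicalSpace E] [TopologicalSpace X]

theorem IsCoveringMap.exists_lift_simplex {p : C(E, X)} (hp : IsCoveringMap p)
    (hsurj : Function.Surjective p) {n : ℕ} (f : C(TopSimplex n, X)) :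
    ∃ F : C(TopSimplex n, E), p.comp F = f := by
  obtain ⟨e, he⟩ := hsurj (f (stdSimplex.vertex 0))
  obtain ⟨F, ⟨-, hF⟩, -⟩ := hp.existsUnique_continuousMap_lifts f (stdSimplex.vertex 0) e he
  exact ⟨F, ContinuousMap.ext (congrFun hF)⟩

/-- `f ∘ G` is again a lift of the same simplex, and lifts from a connected space that agree at one
point agree everywhere. -/
theorem IsCoveringMap.eq_comp_of_lifts {p : C(E, X)} (hp : IsCoveringMap p)
    {n : ℕ} {F G : C(TopSimplex n, E)} (h : p.comp F = p.comp G) (x : TopSimplex n)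
    (f : E → E) (hf : Continuous f) (hpf : ∀ x, p (f x) = p x) (hx : F x = f (G x)) :
    ∀ y, F y = f (G y) := by
  have := hp.eq_of_comp_eq (g₁ := F) (g₂ := fun y => f (G y)) F.continuous
    (hf.comp G.continuous) (by
      ext y; simpa [hpf] using congrArg (fun φ => φ y) h) x hx
  exact congrFun this

end LiftSimplex

/-! ### First homology of a quotient by affine deck transformations -/

section SingularOneChainsOfQuotient

variable {E X : Type} [NormedAddCommGroup E] [NormedSpace ℝ E] [TopologicalSpace X]

/-- The affine singular simplex with given vertices. -/
noncomputable def affineSimplex {n : ℕ} (a : Fin (n + 1) → E) : C(TopSimplex n, E) where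
  toFun x := ∑ i, x i • a i
  continuous_toFun := by
    refine continuous_finsetSum _ fun i _ => Continuous.smul ?_ continuous_const
    exact (continuous_apply i).comp continuous_subtype_val

theorem affineSimplex_apply {n : ℕ} (a : Fin (n + 1) → E) (x : TopSimplex n) :
    affineSimplex a x = ∑ i, x i • a i := rfl

theorem affineSimplex_comp_face {n : ℕ} (a : Fin (n + 2) → E) (i : Fin (n + 2)) :
    (affineSimplex a).comp (faceInclusion i) = affineSimplex (a ∘ i.succAbove) := by
  ext x
  simp [affineSimplex_apply, Fin.sum_univ_succAbove _ i, faceInclusion_apply_self,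
    faceInclusion_apply_succAbove]

theorem affineSimplex_vertex {n : ℕ} (a : Fin (n + 1) → E) (j : Fin (n + 1)) :
    affineSimplex a (stdSimplex.vertex j) = a j := by
  simp [affineSimplex_apply, Pi.single_apply]

theorem affineSimplex_map {n : ℕ} (a : Fin (n + 1) → E) (f : E ≃ᵃ[ℝ] E) (x : TopSimplex n) :
    f (affineSimplex a x) = affineSimplex (f ∘ a) x := by
  have h : ∀ y, f y = f.linear y + f 0 := fun y => by
    simpa using f.map_vadd 0 y
  simp only [affineSimplex_apply, Function.comp_apply]
  rw [h, map_sum]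
  simp_rw [h (a _), smul_add, Finset.sum_add_distrib, ← Finset.sum_smul, stdSimplex.sum_eq_one,
    one_smul, map_smul]

/-- The class of the image of the straight segment from `a` to `b`. -/
noncomputable def segmentClass (p : C(E, X)) (a b : E) : oneChainsModBoundary X :=
  simplexClass (p.comp (affineSimplex ![a, b]))

/-- The three segments bound an affine triangle. -/
theorem segmentClass_add (p : C(E, X)) (a b c : E) :
    segmentClass p a b + segmentClass p b c = segmentClass p a c := by
  have h := simplexClass_boundary (p.comp (affineSimplex ![a, b, c]))
  simp only [ContinuousMap.comp_assoc, affineSimplex_comp_face] at h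
  have h0 : ![a, b, c] ∘ Fin.succAbove 0 = ![b, c] := by ext i; fin_cases i <;> rfl
  have h1 : ![a, b, c] ∘ Fin.succAbove 1 = ![a, c] := by ext i; fin_cases i <;> rfl
  have h2 : ![a, b, c] ∘ Fin.succAbove 2 = ![a, b] := by ext i; fin_cases i <;> rfl
  rw [h0, h1, h2] at h
  rw [segmentClass, segmentClass, segmentClass, ← sub_eq_zero, ← h]
  abel

theorem segmentClass_self (p : C(E, X)) (a : E) : segmentClass p a a = 0 := by
  simpa using segmentClass_add p a a a

/-- An affine map carries segments to segments, so the two sides are one and the same singular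
simplex of `X`. This is why deck transformations are required to be affine. -/
theorem segmentClass_map (p : C(E, X)) (f : E ≃ᵃ[ℝ] E) (hf : ∀ x, p (f x) = p x) (a b : E) :
    segmentClass p (f a) (f b) = segmentClass p a b := by
  unfold segmentClass
  congr 1
  ext x
  have : ![f a, f b] = f ∘ ![a, b] := by ext i; fin_cases i <;> rfl
  simp only [ContinuousMap.comp_apply, this, ← affineSimplex_map, hf]

/-- The triangle `(0,0), (1,0), (1,1)` of the straight-line homotopy between two paths. -/
noncomputable def lowerPrism (F G : C(TopSimplex 1, E)) : C(TopSimplex 2, E) where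
  toFun x := (x 0 + x 1) • F (stdSimplex.map ![0, 1, 1] x) +
    x 2 • G (stdSimplex.map ![0, 1, 1] x)
  continuous_toFun := by
    have h : ∀ i : Fin 3, Continuous fun x : TopSimplex 2 => x i := fun i =>
      (continuous_apply i).comp continuous_subtype_val
    have h' := stdSimplex.continuous_map (S := ℝ) (![0, 1, 1] : Fin 3 → Fin 2)
    exact (((h 0).add (h 1)).smul (F.continuous.comp h')).add ((h 2).smul (G.continuous.comp h'))

/-- The triangle `(0,0), (0,1), (1,1)` of the straight-line homotopy between two paths. -/
noncomputable def upperPrism (F G : C(TopSimplex 1, E)) : C(TopSimplex 2, E) where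
  toFun x := x 0 • F (stdSimplex.map ![0, 0, 1] x) +
    (x 1 + x 2) • G (stdSimplex.map ![0, 0, 1] x)
  continuous_toFun := by
    have h : ∀ i : Fin 3, Continuous fun x : TopSimplex 2 => x i := fun i =>
      (continuous_apply i).comp continuous_subtype_val
    have h' := stdSimplex.continuous_map (S := ℝ) (![0, 0, 1] : Fin 3 → Fin 2)
    exact ((h 0).smul (F.continuous.comp h')).add
      (((h 1).add (h 2)).smul (G.continuous.comp h'))

theorem stdSimplex_map_const {m n : ℕ} (x : TopSimplex m) (j : Fin (n + 1)) :
    stdSimplex.map (fun _ => j) x = stdSimplex.vertex j := by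
  ext i
  simp only [stdSimplex.map_coe, FunOnFinite.linearMap_apply_apply, stdSimplex.vertex_coe,
    Pi.single_apply]
  split_ifs with h
  · simp [h]
  · simp [Ne.symm h]

/-- The straight-line homotopy from `F` to the segment `G` fills a square, cut along its diagonal
into two triangles. As `F` and `G` have the same endpoints, the vertical sides are constant and
contribute nothing. -/
theorem simplexClass_comp_eq_segmentClass (p : C(E, X)) (F : C(TopSimplex 1, E)) :
    simplexClass (p.comp F) =
      segmentClass p (F (stdSimplex.vertex 0)) (F (stdSimplex.vertex 1)) := by
  set a := F (stdSimplex.vertex 0) with ha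
  set b := F (stdSimplex.vertex 1) with hb
  set G := affineSimplex ![a, b] with hG
  have hGa : G (stdSimplex.vertex 0) = a := affineSimplex_vertex _ _
  have hGb : G (stdSimplex.vertex 1) = b := affineSimplex_vertex _ _
  have comp_map : ∀ (f : Fin 3 → Fin 2) (i : Fin 3) (x : TopSimplex 1),
      stdSimplex.map f (faceInclusion i x) = stdSimplex.map (f ∘ i.succAbove) x :=
    fun f i x => stdSimplex.map_comp_apply _ _ _
  have add1 : ∀ x : TopSimplex 1, x 0 + x 1 = 1 := stdSimplex.add_eq_one
  have const_seg : ∀ (v : E) (x : TopSimplex 1), affineSimplex ![v, v] x = v := fun v x => by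
    simp [affineSimplex_apply, ← add_smul, add1]
  have f00 : ∀ x : TopSimplex 1, faceInclusion 0 x (0 : Fin 3) = 0 :=
    fun x => faceInclusion_apply_self _ x
  have f01 : ∀ x : TopSimplex 1, faceInclusion 0 x (1 : Fin 3) = x 0 :=
    fun x => faceInclusion_apply_succAbove (0 : Fin 3) x 0
  have f02 : ∀ x : TopSimplex 1, faceInclusion 0 x (2 : Fin 3) = x 1 :=
    fun x => faceInclusion_apply_succAbove (0 : Fin 3) x 1
  have f10 : ∀ x : TopSimplex 1, faceInclusion 1 x (0 : Fin 3) = x 0 :=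
    fun x => faceInclusion_apply_succAbove (1 : Fin 3) x 0
  have f11 : ∀ x : TopSimplex 1, faceInclusion 1 x (1 : Fin 3) = 0 :=
    fun x => faceInclusion_apply_self _ x
  have f12 : ∀ x : TopSimplex 1, faceInclusion 1 x (2 : Fin 3) = x 1 :=
    fun x => faceInclusion_apply_succAbove (1 : Fin 3) x 1
  have f20 : ∀ x : TopSimplex 1, faceInclusion 2 x (0 : Fin 3) = x 0 :=
    fun x => faceInclusion_apply_succAbove (2 : Fin 3) x 0
  have f21 : ∀ x : TopSimplex 1, faceInclusion 2 x (1 : Fin 3) = x 1 :=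
    fun x => faceInclusion_apply_succAbove (2 : Fin 3) x 1
  have f22 : ∀ x : TopSimplex 1, faceInclusion 2 x (2 : Fin 3) = 0 :=
    fun x => faceInclusion_apply_self _ x
  have l0 : (lowerPrism F G).comp (faceInclusion 0) = affineSimplex ![b, b] := by
    ext x
    have : (![0, 1, 1] : Fin 3 → Fin 2) ∘ Fin.succAbove 0 = fun _ => 1 := by
      ext i; fin_cases i <;> rfl
    rw [const_seg]
    simp only [lowerPrism, ContinuousMap.comp_apply, ContinuousMap.coe_mk, comp_map, this,
      stdSimplex_map_const, f00, f01, f02, hGb, ← hb, ← add_smul, zero_add, add1,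
      one_smul]
  have l1 : (lowerPrism F G).comp (faceInclusion 1) = (upperPrism F G).comp (faceInclusion 1) := by
    ext x
    have h1 : (![0, 1, 1] : Fin 3 → Fin 2) ∘ Fin.succAbove 1 = id := by
      ext i; fin_cases i <;> rfl
    have h2 : (![0, 0, 1] : Fin 3 → Fin 2) ∘ Fin.succAbove 1 = id := by
      ext i; fin_cases i <;> rfl
    simp only [lowerPrism, upperPrism, ContinuousMap.comp_apply, ContinuousMap.coe_mk, comp_map,
      h1, h2, f10, f11, f12, add_zero, zero_add]
  have l2 : (lowerPrism F G).comp (faceInclusion 2) = F := by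
    ext x
    have h1 : (![0, 1, 1] : Fin 3 → Fin 2) ∘ Fin.succAbove 2 = id := by
      ext i; fin_cases i <;> rfl
    simp only [lowerPrism, ContinuousMap.comp_apply, ContinuousMap.coe_mk, comp_map,
      h1, f20, f21, f22, zero_smul, add_zero, add1, one_smul,
      stdSimplex.map_id_apply]
  have u0 : (upperPrism F G).comp (faceInclusion 0) = G := by
    ext x
    have h1 : (![0, 0, 1] : Fin 3 → Fin 2) ∘ Fin.succAbove 0 = id := by
      ext i; fin_cases i <;> rfl
    simp only [upperPrism, ContinuousMap.comp_apply, ContinuousMap.coe_mk, comp_map,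
      h1, f00, f01, f02, zero_smul, zero_add, add1, one_smul,
      stdSimplex.map_id_apply]
  have u2 : (upperPrism F G).comp (faceInclusion 2) = affineSimplex ![a, a] := by
    ext x
    have : (![0, 0, 1] : Fin 3 → Fin 2) ∘ Fin.succAbove 2 = fun _ => 0 := by
      ext i; fin_cases i <;> rfl
    rw [const_seg]
    simp only [upperPrism, ContinuousMap.comp_apply, ContinuousMap.coe_mk, comp_map, this,
      stdSimplex_map_const, f20, f21, f22, hGa, ← ha, ← add_smul, add_zero, add1,
      one_smul]
  -- Both boundary relations involve the common diagonal; eliminating it equates the classes of `F`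
  -- and `G`.
  have hl := simplexClass_boundary (p.comp (lowerPrism F G))
  have hu := simplexClass_boundary (p.comp (upperPrism F G))
  simp only [ContinuousMap.comp_assoc, l0, l1, l2, u0, u2] at hl hu
  have ca : simplexClass (p.comp (affineSimplex ![a, a])) = 0 := segmentClass_self p a
  have cb : simplexClass (p.comp (affineSimplex ![b, b])) = 0 := segmentClass_self p b
  rw [ca, add_zero, sub_eq_zero] at hu
  rw [cb, zero_sub, ← hu, neg_add_eq_zero] at hl
  exact hl.symm

/-- Let a group act affinely on a normed space `E` with orbits the fibres of a covering map
`E → X`. If the abelianization of the group has rank one, detected by `τ`, then the first Betti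
number of `X` is one. -/
theorem firstBettiNumber_eq_one_of_covering {p : C(E, X)} (hp : IsCoveringMap p)
    (hsurj : Function.Surjective p) [FiniteDimensional ℝ E] {Γ : Type*} [Group Γ]
    (ρ : Γ →* (E ≃ᵃ[ℝ] E))
    (hρ : ∀ a b, p a = p b ↔ ∃ γ, ρ γ b = a) (τ : Γ →* Multiplicative ℤ)
    (t : E → ℝ) (ht : ∀ γ x, t (ρ γ x) = t x + (τ γ).toAdd) (γ₀ : Γ) (hγ₀ : (τ γ₀).toAdd = 1)
    (N : ℤ) (hN : N ≠ 0)
    (hab : ∀ γ : Γ, N • (Additive.ofMul (Abelianization.of γ) -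
      (τ γ).toAdd • Additive.ofMul (Abelianization.of γ₀)) = 0) :
    firstBettiNumber X = 1 := by
  have hpρ : ∀ γ x, p (ρ γ x) = p x := fun γ x => (hρ _ _).2 ⟨γ, rfl⟩
  have hcont : ∀ γ, Continuous (ρ γ) := fun γ => (ρ γ).toAffineMap.continuous_of_finiteDimensional
  -- The Hurewicz map on deck transformations: the segment from `0` to its translate projects to a
  -- loop.
  let h : Γ → oneChainsModBoundary X := fun γ => segmentClass p 0 (ρ γ 0)
  have hmul : ∀ γ δ, h (γ * δ) = h γ + h δ := fun γ δ => by
    have h1 : segmentClass p (ρ γ 0) (ρ γ (ρ δ 0)) = h δ :=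
      segmentClass_map p (ρ γ) (hpρ γ) 0 (ρ δ 0)
    change segmentClass p 0 (ρ (γ * δ) 0) = _
    rw [map_mul, AffineEquiv.coe_mul, Function.comp_apply, ← segmentClass_add p 0 (ρ γ 0), h1]
  let hhom : Γ →* Multiplicative (oneChainsModBoundary X) :=
    MonoidHom.mk' (fun γ => Multiplicative.ofAdd (h γ)) fun γ δ => by rw [hmul]; rfl
  -- `hhom` factors through the abelianization, and its target is a rational vector space, so the
  -- factor `N` can be cancelled.
  have hh : ∀ γ, h γ = (τ γ).toAdd • h γ₀ := fun γ => by
    have h1 := congrArg (MonoidHom.toAdditiveLeft (Abelianization.lift hhom)) (hab γ)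
    rw [map_zsmul, map_sub, map_zsmul, map_zero] at h1
    have h2 : N • (h γ - (τ γ).toAdd • h γ₀) = 0 := h1
    rw [← Int.cast_smul_eq_zsmul ℚ, smul_eq_zero, sub_eq_zero] at h2
    exact h2.resolve_left (by exact_mod_cast hN)
  -- A set-theoretic section suffices, since only the values of chains at vertices matter.
  choose s hs using hsurj
  have hseg : ∀ (x : E), ∃ q : ℤ, segmentClass p 0 x = segmentClass p 0 (s (p x)) + q • h γ₀ :=
    fun x => by
      obtain ⟨γ, hγ⟩ := (hρ x (s (p x))).1 (hs _).symm
      refine ⟨(τ γ).toAdd, ?_⟩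
      have h1 := segmentClass_map p (ρ γ) (hpρ γ) 0 (s (p x))
      rw [← hh, ← h1, hγ, add_comm]
      exact (segmentClass_add p 0 (ρ γ 0) x).symm
  let L := Submodule.span ℚ {h γ₀}
  -- A cone operator: it joins `0` to the chosen lift of each point. Changing the lift changes the
  -- result by a multiple of `h γ₀`, so modulo `L` every one-chain is the cone on its boundary and
  -- every cycle lies in `L`.
  let κ : (rationalChains X).X 0 →ₗ[ℚ] oneChainsModBoundary X :=
    chainDesc fun f => segmentClass p 0 (s (f (stdSimplex.vertex 0)))
  have hspan : L.mkQ = (L.mkQ ∘ₗ κ) ∘ₗ boundaryOfClass := by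
    refine oneChainsModBoundary_hom_ext fun f => ?_
    obtain ⟨F, rfl⟩ := hp.exists_lift_simplex (fun x => ⟨s x, hs x⟩) f
    rw [LinearMap.comp_apply, boundaryOfClass_simplexClass, LinearMap.comp_apply, ← sub_eq_zero,
      ← map_sub, Submodule.mkQ_apply, Submodule.Quotient.mk_eq_zero, map_sub,
      chainDesc_simplexChain, chainDesc_simplexChain, simplexClass_comp_eq_segmentClass]
    simp only [ContinuousMap.comp_apply, faceInclusion_vertex]
    obtain ⟨q0, h0⟩ := hseg (F (stdSimplex.vertex 0))
    obtain ⟨q1, h1⟩ := hseg (F (stdSimplex.vertex 1))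
    have e : segmentClass p (F (stdSimplex.vertex 0)) (F (stdSimplex.vertex 1)) -
        (segmentClass p 0 (s (p (F (stdSimplex.vertex 1)))) -
          segmentClass p 0 (s (p (F (stdSimplex.vertex 0))))) = (q1 - q0) • h γ₀ := by
      rw [← sub_eq_iff_eq_add'] at h0 h1
      rw [sub_smul, ← h0, ← h1, ← segmentClass_add p 0 (F (stdSimplex.vertex 0))
        (F (stdSimplex.vertex 1))]
      abel
    change segmentClass p (F (stdSimplex.vertex 0)) (F (stdSimplex.vertex 1)) -
        (segmentClass p 0 (s (p (F (stdSimplex.vertex 1)))) -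
          segmentClass p 0 (s (p (F (stdSimplex.vertex 0))))) ∈ L
    rw [e]
    exact zsmul_mem (Submodule.mem_span_singleton_self _) _
  have hker : LinearMap.ker (boundaryOfClass (X := X)) = L := by
    refine le_antisymm (fun v hv => ?_) ?_
    · have := congrArg (fun φ => φ v) hspan
      simp only [LinearMap.comp_apply, LinearMap.mem_ker.1 hv, map_zero, Submodule.mkQ_apply,
        Submodule.Quotient.mk_eq_zero] at this
      exact this
    · rw [Submodule.span_singleton_le_iff_mem, LinearMap.mem_ker]
      change boundaryOfClass (simplexClass _) = 0
      rw [boundaryOfClass_simplexClass, sub_eq_zero]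
      congr 1
      ext x
      obtain rfl : x = stdSimplex.vertex 0 := Subsingleton.elim _ _
      simp only [ContinuousMap.comp_apply, faceInclusion_vertex, affineSimplex_vertex]
      exact hpρ γ₀ 0
  choose l hl using fun f : C(TopSimplex 1, X) =>
    hp.exists_lift_simplex (fun x => ⟨s x, hs x⟩) f
  -- Two lifts differ by a deck transformation, which shifts `t` by a constant.
  have hindep : ∀ F G : C(TopSimplex 1, E), p.comp F = p.comp G →
      t (F (stdSimplex.vertex 1)) - t (F (stdSimplex.vertex 0)) =
        t (G (stdSimplex.vertex 1)) - t (G (stdSimplex.vertex 0)) := fun F G hFG => by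
    obtain ⟨γ, hγ⟩ := (hρ (F (stdSimplex.vertex 0)) (G (stdSimplex.vertex 0))).1
      (congrArg (fun φ => φ (stdSimplex.vertex 0)) hFG)
    have := hp.eq_comp_of_lifts hFG _ (ρ γ) (hcont γ) (hpρ γ) hγ.symm
    rw [this, this, ht, ht]
    ring
  -- The increase of `t` along a lift is a cocycle, because the differences telescope around a
  -- lifted triangle.
  obtain ⟨φ, hφ⟩ := exists_functional_of_boundary
    (fun f => t (l f (stdSimplex.vertex 1)) - t (l f (stdSimplex.vertex 0))) fun f => by
      obtain ⟨F, rfl⟩ := hp.exists_lift_simplex (fun x => ⟨s x, hs x⟩) f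
      have : ∀ i, t (l ((p.comp F).comp (faceInclusion i)) (stdSimplex.vertex 1)) -
          t (l ((p.comp F).comp (faceInclusion i)) (stdSimplex.vertex 0)) =
          t (F (stdSimplex.vertex (i.succAbove 1))) - t (F (stdSimplex.vertex (i.succAbove 0))) :=
        fun i => by
          rw [hindep (l ((p.comp F).comp (faceInclusion i))) (F.comp (faceInclusion i)) (hl _)]
          simp only [ContinuousMap.comp_apply, faceInclusion_vertex]
      rw [this, this, this]
      change t (F (stdSimplex.vertex 2)) - t (F (stdSimplex.vertex 1)) -
        (t (F (stdSimplex.vertex 2)) - t (F (stdSimplex.vertex 0))) +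
        (t (F (stdSimplex.vertex 1)) - t (F (stdSimplex.vertex 0))) = 0
      ring
  have hne : h γ₀ ≠ 0 := fun h0 => by
    have h1 := hφ (p.comp (affineSimplex ![0, ρ γ₀ 0]))
    rw [hindep _ _ (hl _), affineSimplex_vertex, affineSimplex_vertex] at h1
    have h2 : φ (h γ₀) = t (ρ γ₀ 0) - t 0 := h1
    rw [h0, map_zero, ht, hγ₀] at h2
    simp at h2
  rw [firstBettiNumber_eq_finrank_ker, hker]
  exact finrank_span_singleton hne

end SingularOneChainsOfQuotient

/-! ### Eigenvectors of `m` and the lattice spanned by the `(c_j, α_j)` -/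

section Eigenvectors

open Matrix

theorem Matrix.linearIndependent_of_mulVec_eq_smul {ι κ K : Type*} [Field K] [Fintype κ]
    [DecidableEq κ] (M : Matrix κ κ K) {μ : ι → K} (hμ : Function.Injective μ) {v : ι → κ → K}
    (hv : ∀ i, v i ≠ 0) (h : ∀ i, M *ᵥ v i = μ i • v i) : LinearIndependent K v :=
  Module.End.eigenvectors_linearIndependent' (Matrix.toLin' M) μ hμ v fun i =>
    ⟨Module.End.mem_eigenspace_iff.2 (by simpa using h i), hv i⟩

namespace InoueData

variable (D : InoueData)

/-- The matrix of `D` with complex entries. -/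
noncomputable abbrev complexMatrix : Matrix (Fin 3) (Fin 3) ℂ :=
  (D.m : Matrix (Fin 3) (Fin 3) ℤ).map (Int.cast : ℤ → ℂ)

/-- The eigenvalues `c, α, ᾱ`. -/
noncomputable def eigenvalue : Fin 3 → ℂ := ![(D.c : ℂ), D.α, starRingEnd ℂ D.α]

/-- The eigenvectors for `c, α, ᾱ`. -/
noncomputable def eigenvector : Fin 3 → Fin 3 → ℂ :=
  ![fun j => (D.cvec j : ℂ), D.αvec, fun j => starRingEnd ℂ (D.αvec j)]

theorem mulVec_eigenvector (i : Fin 3) :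
    D.complexMatrix *ᵥ D.eigenvector i = D.eigenvalue i • D.eigenvector i := by
  fin_cases i
  · ext j
    have := congrArg (fun x : ℝ => (x : ℂ)) (congrFun D.mulVec_cvec j)
    simpa [eigenvector, eigenvalue, Matrix.mulVec, dotProduct] using this
  · exact D.mulVec_αvec
  · ext j
    have := congrArg (starRingEnd ℂ) (congrFun D.mulVec_αvec j)
    simpa [eigenvector, eigenvalue, Matrix.mulVec, dotProduct] using this

theorem eigenvector_ne_zero (i : Fin 3) : D.eigenvector i ≠ 0 := by
  fin_cases i
  · intro h
    refine D.cvec_ne_zero (funext fun j => ?_)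
    simpa [eigenvector] using congrFun h j
  · exact D.αvec_ne_zero
  · intro h
    refine D.αvec_ne_zero (funext fun j => ?_)
    simpa [eigenvector] using congrFun h j

theorem eigenvalue_injective : Function.Injective D.eigenvalue := by
  have h := D.α_im_ne_zero
  have h1 : (D.c : ℂ) ≠ D.α := fun e => h (by simp [← e])
  have h2 : (D.c : ℂ) ≠ starRingEnd ℂ D.α := fun e => h (by
    have := congrArg Complex.im e; simpa using this.symm)
  have h3 : D.α ≠ starRingEnd ℂ D.α := fun e => h (Complex.conj_eq_iff_im.1 e.symm)
  intro i j hij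
  fin_cases i <;> fin_cases j <;>
    simp_all [eigenvalue, Ne.symm h1, Ne.symm h2, Ne.symm h3]

theorem eigenvalue_ne_one (i : Fin 3) : D.eigenvalue i ≠ 1 := by
  have h := D.α_im_ne_zero
  fin_cases i
  · intro e
    have e' : (D.c : ℂ) = 1 := e
    exact D.one_lt_c.ne' (by exact_mod_cast e')
  · intro e
    have e' : D.α = 1 := e
    exact h (by simp [e'])
  · intro e
    have e' : starRingEnd ℂ D.α = 1 := e
    have := congrArg Complex.im e'
    exact h (by simpa using this)

theorem linearIndependent_eigenvector : LinearIndependent ℂ D.eigenvector :=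
  Matrix.linearIndependent_of_mulVec_eq_smul _ D.eigenvalue_injective D.eigenvector_ne_zero
    D.mulVec_eigenvector

/-- A fixed vector of `m` would be an eigenvector for a fourth eigenvalue, giving four independent
vectors in `ℂ³`. -/
theorem det_sub_one_ne_zero : ((D.m : Matrix (Fin 3) (Fin 3) ℤ) - 1).det ≠ 0 := by
  intro h
  have hc : (D.complexMatrix - 1).det = 0 := by
    have := congrArg (Int.castRingHom ℂ) h
    rw [RingHom.map_det] at this
    simpa [Matrix.map_sub, RingHom.mapMatrix_apply] using this
  obtain ⟨v, hv0, hv⟩ := Matrix.exists_mulVec_eq_zero_iff.2 hc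
  rw [Matrix.sub_mulVec, Matrix.one_mulVec, sub_eq_zero] at hv
  have hli : LinearIndependent ℂ (Fin.cons v D.eigenvector : Fin 4 → Fin 3 → ℂ) := by
    refine Matrix.linearIndependent_of_mulVec_eq_smul D.complexMatrix
      (μ := Fin.cons 1 D.eigenvalue) ?_ ?_ ?_
    · rw [Fin.cons_injective_iff]
      exact ⟨fun ⟨i, hi⟩ => D.eigenvalue_ne_one i hi, D.eigenvalue_injective⟩
    · exact Fin.cases hv0 D.eigenvector_ne_zero
    · exact Fin.cases (by simpa using hv) D.mulVec_eigenvector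
  simpa using hli.fintype_card_le_finrank

/-- The linear combinations of the vectors `(c_j, α_j)`. -/
noncomputable def latticeMap : (Fin 3 → ℝ) →ₗ[ℝ] ℝ × ℂ where
  toFun r := (∑ j, r j * D.cvec j, ∑ j, r j * D.αvec j)
  map_add' r s := by simp [add_mul, Finset.sum_add_distrib]
  map_smul' a r := by simp [mul_assoc, Finset.mul_sum]

/-- A real relation `r` is a linear form on `ℂ³` vanishing on the `c`- and `α`-eigenvectors. Having
real coefficients, it also vanishes on the conjugate of the latter, hence on a basis. -/
theorem latticeMap_injective : Function.Injective D.latticeMap := by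
  rw [injective_iff_map_eq_zero]
  intro r hr
  have hr1 : ∑ j, r j * D.cvec j = 0 := congrArg Prod.fst hr
  have hr2 : ∑ j, (r j : ℂ) * D.αvec j = 0 := congrArg Prod.snd hr
  let f : (Fin 3 → ℂ) →ₗ[ℂ] ℂ := Fintype.linearCombination ℂ fun j => (r j : ℂ)
  have hf : ∀ i, f (D.eigenvector i) = 0 := by
    intro i
    fin_cases i
    · have := congrArg (fun x : ℝ => (x : ℂ)) hr1
      simpa [f, Fintype.linearCombination_apply, eigenvector, mul_comm] using this
    · simpa [f, Fintype.linearCombination_apply, eigenvector, mul_comm] using hr2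
    · have := congrArg (starRingEnd ℂ) hr2
      simpa [f, Fintype.linearCombination_apply, eigenvector, mul_comm] using this
  have hf0 : f = 0 := by
    refine (basisOfLinearIndependentOfCardEqFinrank D.linearIndependent_eigenvector
      (by simp)).ext fun i => ?_
    simpa using hf i
  ext j
  have := congrArg (fun φ => φ (Pi.single j 1)) hf0
  simpa [f, Fintype.linearCombination_apply, Pi.single_apply] using this

/-- The vectors `(c_j, α_j)` form a basis of `ℝ × ℂ`. -/
noncomputable def latticeEquiv : (Fin 3 → ℝ) ≃L[ℝ] ℝ × ℂ :=
  (LinearEquiv.ofInjectiveOfFinrankEq D.latticeMap D.latticeMap_injective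
    (by simp [Complex.finrank_real_complex])).toContinuousLinearEquiv

theorem latticeEquiv_apply (r : Fin 3 → ℝ) :
    D.latticeEquiv r = (∑ j, r j * D.cvec j, ∑ j, r j * D.αvec j) := rfl

/-- The integral linear combinations of the vectors `(c_j, α_j)`. -/
noncomputable def latticePoint (k : Fin 3 → ℤ) : ℝ × ℂ := D.latticeEquiv fun j => (k j : ℝ)

theorem latticePoint_eq (k : Fin 3 → ℤ) :
    D.latticePoint k = (∑ j, k j * D.cvec j, ∑ j, k j * D.αvec j) := by
  simp [latticePoint, latticeEquiv_apply]

theorem latticePoint_add (k l : Fin 3 → ℤ) :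
    D.latticePoint (k + l) = D.latticePoint k + D.latticePoint l := by
  simp only [latticePoint, ← map_add]
  congr 1; ext j; simp

theorem latticePoint_neg (k : Fin 3 → ℤ) : D.latticePoint (-k) = -D.latticePoint k := by
  simp only [latticePoint, ← map_neg]
  congr 1; ext j; simp

theorem latticePoint_zero : D.latticePoint 0 = 0 := by
  simp only [latticePoint]
  convert map_zero D.latticeEquiv using 2
  ext j; simp

theorem latticePoint_single (j : Fin 3) :
    D.latticePoint (Pi.single j 1) = (D.cvec j, D.αvec j) := by
  simp [latticePoint_eq, Pi.single_apply]

/-- This is associativity, `(k m) · v = k · (m v)`, applied to the two eigenvectors. -/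
theorem latticePoint_vecMul (k : Fin 3 → ℤ) :
    D.latticePoint (k ᵥ* (D.m : Matrix (Fin 3) (Fin 3) ℤ)) =
      (D.c * (D.latticePoint k).1, D.α * (D.latticePoint k).2) := by
  have h1 := D.mulVec_cvec
  have h2 := D.mulVec_αvec
  simp only [latticePoint_eq]
  refine Prod.ext ?_ ?_
  · have := Matrix.dotProduct_mulVec (fun j => (k j : ℝ))
      ((D.m : Matrix (Fin 3) (Fin 3) ℤ).map (Int.cast : ℤ → ℝ)) D.cvec
    rw [h1] at this
    simp only [Matrix.vecMul, dotProduct, Matrix.map_apply, Pi.smul_apply, smul_eq_mul,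
      Int.cast_sum, Int.cast_mul] at this ⊢
    rw [← this, Finset.mul_sum]
    exact Finset.sum_congr rfl fun j _ => by ring
  · have := Matrix.dotProduct_mulVec (fun j => (k j : ℂ))
      ((D.m : Matrix (Fin 3) (Fin 3) ℤ).map (Int.cast : ℤ → ℂ)) D.αvec
    rw [h2] at this
    simp only [Matrix.vecMul, dotProduct, Matrix.map_apply, Pi.smul_apply, smul_eq_mul,
      Int.cast_sum, Int.cast_mul] at this ⊢
    rw [← this, Finset.mul_sum]
    exact Finset.sum_congr rfl fun j _ => by ring

theorem exists_latticePoint_zpow (n : ℤ) (k : Fin 3 → ℤ) :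
    ∃ l, D.latticePoint l =
      (D.c ^ n * (D.latticePoint k).1, D.α ^ n * (D.latticePoint k).2) := by
  have hc := D.c_pos.ne'
  have hα := D.α_ne_zero
  induction n with
  | zero => exact ⟨k, by simp⟩
  | succ n ih =>
    obtain ⟨l, hl⟩ := ih
    refine ⟨l ᵥ* (D.m : Matrix (Fin 3) (Fin 3) ℤ), ?_⟩
    rw [latticePoint_vecMul, hl, zpow_add_one₀ hc, zpow_add_one₀ hα]
    refine Prod.ext ?_ ?_ <;> simp only <;> ring
  | pred n ih =>
    obtain ⟨l, hl⟩ := ih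
    -- Here `det m = 1` matters: the inverse of `m` is integral, so division by `(c, α)` also
    -- preserves the lattice.
    refine ⟨l ᵥ* ((D.m⁻¹ : Matrix.SpecialLinearGroup (Fin 3) ℤ) : Matrix (Fin 3) (Fin 3) ℤ), ?_⟩
    have h := D.latticePoint_vecMul
      (l ᵥ* ((D.m⁻¹ : Matrix.SpecialLinearGroup (Fin 3) ℤ) : Matrix (Fin 3) (Fin 3) ℤ))
    rw [Matrix.vecMul_vecMul, ← Matrix.SpecialLinearGroup.coe_mul, inv_mul_cancel,
      Matrix.SpecialLinearGroup.coe_one, Matrix.vecMul_one, hl] at h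
    have h1 := congrArg Prod.fst h
    have h2 := congrArg Prod.snd h
    simp only at h1 h2
    rw [zpow_sub_one₀ hc, zpow_sub_one₀ hα]
    refine Prod.ext ?_ ?_ <;> simp only
    · rw [mul_right_comm, h1]; field_simp
    · rw [mul_right_comm, h2]; field_simp

end InoueData

end Eigenvectors

/-! ### Gaussian integers and the quarter rotation -/

section GaussianIntegers

/-- The Gaussian integers as a subring of `ℂ`. -/
def gaussianSubring : Subring ℂ := GaussianInt.toComplex.range

theorem mem_gaussianSubring {w : ℂ} :
    w ∈ gaussianSubring ↔ ∃ a b : ℤ, w = a + b * Complex.I := by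
  constructor
  · rintro ⟨x, rfl⟩
    exact ⟨x.re, x.im, GaussianInt.toComplex_def x⟩
  · rintro ⟨a, b, rfl⟩
    exact ⟨⟨a, b⟩, GaussianInt.toComplex_def' a b⟩

theorem I_mem_gaussianSubring : Complex.I ∈ gaussianSubring :=
  mem_gaussianSubring.2 ⟨0, 1, by simp⟩

theorem quarterRotation_intCast (n : ℤ) : quarterRotation n = Complex.I ^ n := by
  have h : Complex.exp (Complex.I * (Real.pi / 2)) = Complex.I := by
    rw [mul_comm]; exact_mod_cast Complex.exp_pi_div_two_mul_I
  rw [quarterRotation, Complex.ofReal_intCast, mul_comm, Complex.exp_int_mul, h]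

/-- `i` is a unit of `ℤ[i]`, with inverse `-i`, so negative powers remain integral. -/
theorem quarterRotation_intCast_mem (n : ℤ) : quarterRotation n ∈ gaussianSubring := by
  rw [quarterRotation_intCast]
  cases n with
  | ofNat n =>
    simpa using pow_mem I_mem_gaussianSubring n
  | negSucc n =>
    rw [zpow_negSucc, ← inv_pow, Complex.inv_I]
    exact pow_mem (neg_mem I_mem_gaussianSubring) _

end GaussianIntegers

/-! ### The elements, relations and abelianization of `Γ` -/

section Lattices

variable (D : InoueData)

/-- The translation subgroup of the six-dimensional group. -/
def translationHom : Multiplicative (ℝ × ℂ × ℂ) →* Sol6 D where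
  toFun x := ⟨0, x.toAdd.1, x.toAdd.2.1, x.toAdd.2.2⟩
  map_one' := rfl
  map_mul' x y := by
    ext <;> simp [Sol6.mul_def, quarterRotation_zero, add_comm]

theorem translationHom_ofAdd (u : ℝ) (z w : ℂ) :
    translationHom D (Multiplicative.ofAdd (u, z, w)) = ⟨0, u, z, w⟩ := rfl

theorem g0_mem : g0 D ∈ Gamma6 D := Subgroup.subset_closure (Or.inl (Or.inl rfl))

theorem gTrans_mem (j : Fin 3) : gTrans D j ∈ Gamma6 D :=
  Subgroup.subset_closure (Or.inl (Or.inr ⟨j, rfl⟩))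

theorem g4_mem : g4 D ∈ Gamma6 D := Subgroup.subset_closure (Or.inr (Or.inl rfl))

theorem g5_mem : g5 D ∈ Gamma6 D := Subgroup.subset_closure (Or.inr (Or.inr rfl))

theorem Gamma6_map_forgetHom : (Gamma6 D).map (forgetHom D) = Gamma4 D := by
  refine le_antisymm (Subgroup.map_le_iff_le_comap.2 fun g hg => forgetHom_mem D hg) ?_
  refine (Subgroup.closure_le _).2 ?_
  rintro x (hx | ⟨j, rfl⟩)
  · rw [Set.mem_singleton_iff.1 hx]
    exact ⟨g0 D, g0_mem D, rfl⟩
  · exact ⟨gTrans D j, gTrans_mem D j, rfl⟩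

/-- Translations form the image of an additive group, so powers and products can be computed
additively. -/
theorem prod_gTrans (k : Fin 3 → ℤ) :
    gTrans D 0 ^ k 0 * gTrans D 1 ^ k 1 * gTrans D 2 ^ k 2 =
      ⟨0, (D.latticePoint k).1, (D.latticePoint k).2, 0⟩ := by
  have h : ∀ j, gTrans D j = translationHom D
    (Multiplicative.ofAdd (D.cvec j, D.αvec j, 0)) := fun j => rfl
  rw [h, h, h, ← map_zpow (translationHom D), ← map_zpow (translationHom D),
    ← map_zpow (translationHom D), ← map_mul, ← map_mul, ← ofAdd_zsmul,
    ← ofAdd_zsmul, ← ofAdd_zsmul, ← ofAdd_add, ← ofAdd_add, ← translationHom_ofAdd]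
  congr 2
  simp [InoueData.latticePoint_eq, Fin.sum_univ_three]

theorem prod_g4_g5 (a b : ℤ) :
    g4 D ^ a * g5 D ^ b = ⟨0, 0, 0, a + b * Complex.I⟩ := by
  have h4 : g4 D = translationHom D (Multiplicative.ofAdd (0, 0, 1)) := rfl
  have h5 : g5 D = translationHom D (Multiplicative.ofAdd (0, 0, Complex.I)) := rfl
  rw [h4, h5, ← map_zpow (translationHom D), ← map_zpow (translationHom D), ← map_mul, ← ofAdd_zsmul, ← ofAdd_zsmul, ← ofAdd_add,
    ← translationHom_ofAdd]
  congr 2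
  simp

theorem fiberTranslation_mem {w : ℂ} (hw : w ∈ gaussianSubring) :
    (⟨0, 0, 0, w⟩ : Sol6 D) ∈ Gamma6 D := by
  obtain ⟨a, b, rfl⟩ := mem_gaussianSubring.1 hw
  rw [← prod_g4_g5]
  exact mul_mem (zpow_mem (g4_mem D) _) (zpow_mem (g5_mem D) _)

theorem latticeTranslation_mem (k : Fin 3 → ℤ) {w : ℂ} (hw : w ∈ gaussianSubring) :
    (⟨0, (D.latticePoint k).1, (D.latticePoint k).2, w⟩ : Sol6 D) ∈ Gamma6 D := by
  have h : (⟨0, (D.latticePoint k).1, (D.latticePoint k).2, w⟩ : Sol6 D) =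
      ⟨0, (D.latticePoint k).1, (D.latticePoint k).2, 0⟩ * ⟨0, 0, 0, w⟩ := by
    simp [Sol6.mul_def, quarterRotation_zero]
  rw [h, ← prod_gTrans]
  exact mul_mem (mul_mem (mul_mem (zpow_mem (gTrans_mem D _) _) (zpow_mem (gTrans_mem D _) _))
    (zpow_mem (gTrans_mem D _) _)) (fiberTranslation_mem D hw)

theorem g0_zpow (n : ℤ) : g0 D ^ n = ⟨n, 0, 0, 0⟩ := by
  let f : Multiplicative ℝ →* Sol6 D :=
    { toFun := fun t => ⟨t.toAdd, 0, 0, 0⟩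
      map_one' := rfl
      map_mul' := fun s t => by ext <;> simp [Sol6.mul_def] }
  have h : g0 D = f (Multiplicative.ofAdd 1) := rfl
  rw [h, ← map_zpow, ← ofAdd_zsmul]
  ext <;> simp [f]

/-- The elements of the lattice, explicitly. -/
theorem exists_of_mem_Gamma6 {g : Sol6 D} (hg : g ∈ Gamma6 D) :
    ∃ (n : ℤ) (k : Fin 3 → ℤ), g.t = n ∧ (g.u, g.z) = D.latticePoint k ∧
      g.w ∈ gaussianSubring := by
  -- An element at time `n` multiplies the `(u, z)` part of what follows it by `(c ^ n, α ^ n)`;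
  -- this keeps products and inverses in the lattice.
  have hrot : ∀ (n : ℤ) (k : Fin 3 → ℤ), ∃ l, D.latticePoint l =
      (D.c ^ (n : ℝ) * (D.latticePoint k).1, D.α ^ ((n : ℝ) : ℂ) * (D.latticePoint k).2) := by
    intro n k
    obtain ⟨l, hl⟩ := D.exists_latticePoint_zpow n k
    exact ⟨l, by rw [hl, Real.rpow_intCast, Complex.ofReal_intCast, Complex.cpow_intCast]⟩
  induction hg using Subgroup.closure_induction with
  | mem x hx =>
    rcases hx with (hx | ⟨j, rfl⟩) | hx | hx
    · rw [Set.mem_singleton_iff.1 hx]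
      exact ⟨1, 0, by simp [g0], by simp [g0, D.latticePoint_zero], zero_mem _⟩
    · exact ⟨0, Pi.single j 1, by simp [gTrans], by simp [gTrans, D.latticePoint_single],
        zero_mem _⟩
    · rw [hx]
      exact ⟨0, 0, by simp [g4], by simp [g4, D.latticePoint_zero], one_mem _⟩
    · rw [Set.mem_singleton_iff.1 hx]
      exact ⟨0, 0, by simp [g5], by simp [g5, D.latticePoint_zero], I_mem_gaussianSubring⟩
  | one => exact ⟨0, 0, by simp [Sol6.one_def], by simp [Sol6.one_def, D.latticePoint_zero],
      zero_mem _⟩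
  | mul x y _ _ hx hy =>
    obtain ⟨n, k, hn, hk, hw⟩ := hx
    obtain ⟨n', k', hn', hk', hw'⟩ := hy
    obtain ⟨l, hl⟩ := hrot n k'
    refine ⟨n + n', l + k, ?_, ?_, ?_⟩
    · simp [Sol6.mul_def, hn, hn']
    · rw [D.latticePoint_add, hl, ← hk, ← hk', Sol6.mul_def, hn]
      rfl
    · rw [Sol6.mul_def, hn]
      exact add_mem (mul_mem (quarterRotation_intCast_mem n) hw') hw
  | inv x _ hx =>
    obtain ⟨n, k, hn, hk, hw⟩ := hx
    obtain ⟨l, hl⟩ := hrot (-n) k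
    refine ⟨-n, -l, ?_, ?_, ?_⟩
    · simp [Sol6.inv_def, hn]
    · rw [D.latticePoint_neg, hl, ← hk, Sol6.inv_def, hn]
      simp
    · have := quarterRotation_intCast_mem (-n)
      rw [Int.cast_neg] at this
      rw [Sol6.inv_def, hn]
      exact neg_mem (mul_mem this hw)

theorem commutator_g0_g4 : ⁅g0 D, g4 D⁆ = (g4 D)⁻¹ * g5 D := by
  have h1 : quarterRotation 1 = Complex.I := by simpa using quarterRotation_intCast 1
  rw [commutatorElement_def]
  ext <;> simp [g0, g4, g5, Sol6.mul_def, Sol6.inv_def, quarterRotation_zero, h1,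
    ← sub_eq_add_neg, sub_eq_neg_add]

theorem commutator_g0_g5 : ⁅g0 D, g5 D⁆ = (g4 D)⁻¹ * (g5 D)⁻¹ := by
  have h1 : quarterRotation 1 = Complex.I := by simpa using quarterRotation_intCast 1
  rw [commutatorElement_def]
  ext <;> simp [g0, g4, g5, Sol6.mul_def, Sol6.inv_def, quarterRotation_zero, h1]

/-- Row `j` of the two eigenvector equations, read in the group. -/
theorem conj_g0_gTrans (j : Fin 3) :
    g0 D * gTrans D j * (g0 D)⁻¹ = gTrans D 0 ^ (D.m : Matrix (Fin 3) (Fin 3) ℤ) j 0 *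
      gTrans D 1 ^ (D.m : Matrix (Fin 3) (Fin 3) ℤ) j 1 *
      gTrans D 2 ^ (D.m : Matrix (Fin 3) (Fin 3) ℤ) j 2 := by
  rw [prod_gTrans D ((D.m : Matrix (Fin 3) (Fin 3) ℤ) j), InoueData.latticePoint_eq]
  have h1 := congrFun D.mulVec_cvec j
  have h2 := congrFun D.mulVec_αvec j
  simp only [Matrix.mulVec, dotProduct, Matrix.map_apply, Pi.smul_apply, smul_eq_mul] at h1 h2
  rw [h1, h2]
  ext <;> simp [g0, gTrans, Sol6.mul_def, Sol6.inv_def]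

/-- The homomorphism `t : Γ → ℤ`. -/
noncomputable def timeHom : Gamma6 D →* Multiplicative ℤ where
  -- On `Γ` the coordinate `t` is already an integer; the floor only changes its type.
  toFun g := Multiplicative.ofAdd ⌊(g : Sol6 D).t⌋
  map_one' := by
    change Multiplicative.ofAdd ⌊(0 : ℝ)⌋ = 1
    simp
  map_mul' g h := by
    obtain ⟨n, -, hn, -, -⟩ := exists_of_mem_Gamma6 D g.2
    obtain ⟨n', -, hn', -, -⟩ := exists_of_mem_Gamma6 D h.2
    simp [Sol6.mul_def, hn, hn', ← ofAdd_add]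

theorem timeHom_cast (g : Gamma6 D) : ((timeHom D g).toAdd : ℝ) = (g : Sol6 D).t := by
  obtain ⟨n, -, hn, -, -⟩ := exists_of_mem_Gamma6 D g.2
  simp [timeHom, hn]

theorem timeHom_g0 : (timeHom D ⟨g0 D, g0_mem D⟩).toAdd = 1 := by
  simp [timeHom, g0]

/-- Multiply the relations by the adjugate matrix. -/
theorem det_smul_eq_zero_of_relations {A : Type*} [AddCommGroup A] {n : Type*} [Fintype n]
    [DecidableEq n] (M : Matrix n n ℤ) (x : n → A) (h : ∀ j, ∑ k, M j k • x k = 0) (i : n) :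
    M.det • x i = 0 := by
  have h1 : ∑ k, (M.adjugate * M) i k • x k = 0 := by
    simp_rw [Matrix.mul_apply, Finset.sum_smul, mul_smul]
    rw [Finset.sum_comm]
    simp_rw [← Finset.smul_sum, h, smul_zero, Finset.sum_const_zero]
  rw [Matrix.adjugate_mul] at h1
  simpa [Matrix.one_apply, Matrix.smul_apply] using h1

/-- Up to torsion, the class of `γ` in the abelianization is a multiple of that of `g₀`. -/
theorem abelianization_Gamma6 (γ : Gamma6 D) :
    (2 * ((D.m : Matrix (Fin 3) (Fin 3) ℤ) - 1).det) •
      (Additive.ofMul (Abelianization.of γ) - (timeHom D γ).toAdd •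
        Additive.ofMul (Abelianization.of (⟨g0 D, g0_mem D⟩ : Gamma6 D))) = 0 := by
  let cls : Gamma6 D → Additive (Abelianization (Gamma6 D)) :=
    fun γ => Additive.ofMul (Abelianization.of γ)
  have cls_mul : ∀ a b, cls (a * b) = cls a + cls b := fun a b => by simp [cls]
  have cls_inv : ∀ a, cls a⁻¹ = -cls a := fun a => by simp [cls]
  have cls_zpow : ∀ a (n : ℤ), cls (a ^ n) = n • cls a := fun a n => by simp [cls]
  have cls_one : cls 1 = 0 := by simp [cls]
  let e0 : Gamma6 D := ⟨g0 D, g0_mem D⟩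
  let e : Fin 3 → Gamma6 D := fun j => ⟨gTrans D j, gTrans_mem D j⟩
  let e4 : Gamma6 D := ⟨g4 D, g4_mem D⟩
  let e5 : Gamma6 D := ⟨g5 D, g5_mem D⟩
  -- The commutators become trivial in the abelianization; the two relations together leave `2[g₄] =
  -- 0`.
  have h4 : cls e5 = cls e4 := by
    have h : e0 * e4 * e0⁻¹ * e4⁻¹ = e4⁻¹ * e5 := Subtype.ext (commutator_g0_g4 D)
    have := congrArg cls h
    simp only [cls_mul, cls_inv] at this
    rw [add_neg_cancel_comm, add_neg_cancel, eq_comm, neg_add_eq_zero] at this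
    exact this.symm
  have h5 : cls e4 + cls e5 = 0 := by
    have h : e0 * e5 * e0⁻¹ * e5⁻¹ = e4⁻¹ * e5⁻¹ := Subtype.ext (commutator_g0_g5 D)
    have := congrArg cls h
    simp only [cls_mul, cls_inv] at this
    rw [add_neg_cancel_comm, add_neg_cancel, eq_comm, ← neg_add, neg_eq_zero] at this
    exact this
  have h24 : (2 : ℤ) • cls e4 = 0 := by rw [two_smul]; rwa [h4] at h5
  -- Conjugation by `g₀` becomes trivial, so `m - 1` annihilates the vector of classes of `g₁, g₂,
  -- g₃`.
  have hj : ∀ j, ((D.m : Matrix (Fin 3) (Fin 3) ℤ) - 1).det • cls (e j) = 0 := by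
    refine det_smul_eq_zero_of_relations _ (fun j => cls (e j)) fun j => ?_
    have h : e0 * e j * e0⁻¹ = e 0 ^ (D.m : Matrix (Fin 3) (Fin 3) ℤ) j 0 *
      e 1 ^ (D.m : Matrix (Fin 3) (Fin 3) ℤ) j 1 *
      e 2 ^ (D.m : Matrix (Fin 3) (Fin 3) ℤ) j 2 := Subtype.ext (conj_g0_gTrans D j)
    have h' := congrArg cls h
    simp only [cls_mul, cls_inv, cls_zpow] at h'
    rw [add_neg_cancel_comm] at h'
    simp only [Matrix.sub_apply, sub_smul, Finset.sum_sub_distrib, Matrix.one_apply, ite_smul,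
      one_smul, zero_smul, Finset.sum_ite_eq, Finset.mem_univ, if_true]
    rw [Fin.sum_univ_three, ← h', sub_self]
  -- The expression to be shown zero is a homomorphism in `γ`, so it can be checked on generators.
  let ψ : Gamma6 D →* Multiplicative (Additive (Abelianization (Gamma6 D))) :=
    MonoidHom.mk' (fun γ => Multiplicative.ofAdd
      ((2 * ((D.m : Matrix (Fin 3) (Fin 3) ℤ) - 1).det) •
        (cls γ - (timeHom D γ).toAdd • cls e0))) fun a b => by
      rw [← ofAdd_add, cls_mul, map_mul, toAdd_mul, add_smul, ← smul_add]
      congr 2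
      abel
  have hψ : ψ = 1 := by
    have hcl : Subgroup.closure ((Subtype.val : Gamma6 D → Sol6 D) ⁻¹'
        ({g0 D} ∪ Set.range (gTrans D) ∪ {g4 D, g5 D})) = ⊤ :=
      Subgroup.closure_closure_coe_preimage
    refine MonoidHom.eq_of_eqOn_dense hcl ?_
    have key : ∀ (x : Gamma6 D), (timeHom D x).toAdd = 0 →
        (2 * ((D.m : Matrix (Fin 3) (Fin 3) ℤ) - 1).det) • cls x = 0 → ψ x = 1 := by
      intro x h1 h2
      change Multiplicative.ofAdd ((2 * ((D.m : Matrix (Fin 3) (Fin 3) ℤ) - 1).det) •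
        (cls x - (timeHom D x).toAdd • cls e0)) = _
      rw [h1, zero_smul, sub_zero, h2]
      rfl
    rintro ⟨x, hx⟩ ((h | ⟨j, h⟩) | h | h)
    · obtain rfl : x = g0 D := h
      change Multiplicative.ofAdd ((2 * ((D.m : Matrix (Fin 3) (Fin 3) ℤ) - 1).det) •
        (cls e0 - (timeHom D e0).toAdd • cls e0)) = _
      rw [timeHom_g0, one_smul, sub_self, smul_zero]
      rfl
    · obtain rfl : gTrans D j = x := h
      refine key _ (by simp [timeHom, gTrans]) ?_
      rw [mul_smul]
      exact (congrArg _ (hj j)).trans (smul_zero _)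
    · obtain rfl : x = g4 D := h
      refine key _ (by simp [timeHom, g4]) ?_
      rw [mul_comm, mul_smul]
      exact (congrArg _ h24).trans (smul_zero _)
    · obtain rfl : x = g5 D := h
      refine key _ (by simp [timeHom, g5]) ?_
      rw [mul_comm, mul_smul]
      exact (congrArg _ ((congrArg _ h4).trans h24)).trans (smul_zero _)
  exact congrArg (fun φ => (φ γ).toAdd) hψ

theorem two_mul_det_ne_zero : 2 * ((D.m : Matrix (Fin 3) (Fin 3) ℤ) - 1).det ≠ 0 :=
  mul_ne_zero two_ne_zero D.det_sub_one_ne_zero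

/-- The time homomorphism maps onto `ℤ` with torsion kernel, and rank is additive. -/
theorem finrank_abelianization_Gamma6 :
    Module.finrank ℤ (Additive (Abelianization (Gamma6 D))) = 1 := by
  let f : Additive (Abelianization (Gamma6 D)) →ₗ[ℤ] ℤ :=
    (MonoidHom.toAdditiveLeft (Abelianization.lift (timeHom D))).toIntLinearMap
  have hf : ∀ γ, f (Additive.ofMul (Abelianization.of γ)) = (timeHom D γ).toAdd := fun γ => rfl
  have hsurj : LinearMap.range f = ⊤ := by
    refine (Ideal.eq_top_iff_one _).2 ⟨Additive.ofMul (Abelianization.of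
      ⟨g0 D, g0_mem D⟩), (hf _).trans (timeHom_g0 D)⟩
  have hker : Module.rank ℤ (LinearMap.ker f) = 0 := by
    rw [rank_eq_zero_iff]
    rintro ⟨x, hx⟩
    refine ⟨_, two_mul_det_ne_zero D, Subtype.ext ?_⟩
    obtain ⟨γ, hγ⟩ := QuotientGroup.mk_surjective x.toMul
    have hxγ : x = Additive.ofMul (Abelianization.of γ) := congrArg Additive.ofMul hγ.symm
    have h := abelianization_Gamma6 D γ
    rw [LinearMap.mem_ker, hxγ, hf] at hx
    rw [hx, zero_smul, sub_zero, ← hxγ] at h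
    exact h
  have h := LinearMap.rank_range_add_rank_ker f
  rw [hker, hsurj, add_zero, rank_top, Module.rank_self] at h
  rw [Module.finrank, ← h, map_one]

end Lattices

/-! ### Proper discontinuity, compactness and the covering maps -/

section SolvableTopology

open Filter Topology

variable (D : InoueData)

theorem continuous_quarterRotation : Continuous quarterRotation := by
  unfold quarterRotation
  fun_prop

theorem InoueData.continuous_rpow : Continuous fun t : ℝ => D.c ^ t :=
  continuous_const.rpow continuous_id fun _ => Or.inl D.c_pos.ne'

theorem InoueData.continuous_cpow : Continuous fun t : ℝ => D.α ^ (t : ℂ) :=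
  Complex.continuous_ofReal.const_cpow (Or.inl D.α_ne_zero)

/-- The coordinates on the four-dimensional group as a homeomorphism. -/
noncomputable def Sol4.coordsHomeomorph : Sol4 D ≃ₜ ℝ × ℝ × ℂ :=
  (Sol4.coords D).toHomeomorphOfIsInducing ⟨rfl⟩

/-- The coordinates on the six-dimensional group as a homeomorphism. -/
noncomputable def Sol6.coordsHomeomorph : Sol6 D ≃ₜ ℝ × ℝ × ℂ × ℂ :=
  (Sol6.coords D).toHomeomorphOfIsInducing ⟨rfl⟩

instance : T2Space (Sol4 D) := (Sol4.coordsHomeomorph D).symm.t2Space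
instance : T2Space (Sol6 D) := (Sol6.coordsHomeomorph D).symm.t2Space
instance : LocallyCompactSpace (Sol4 D) :=
  (Sol4.coordsHomeomorph D).isClosedEmbedding.locallyCompactSpace
instance : LocallyCompactSpace (Sol6 D) :=
  (Sol6.coordsHomeomorph D).isClosedEmbedding.locallyCompactSpace

theorem Sol4.continuous_t : Continuous (Sol4.t : Sol4 D → ℝ) :=
  continuous_fst.comp (Sol4.coordsHomeomorph D).continuous
theorem Sol4.continuous_u : Continuous (Sol4.u : Sol4 D → ℝ) :=
  (continuous_fst.comp continuous_snd).comp (Sol4.coordsHomeomorph D).continuous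
theorem Sol4.continuous_z : Continuous (Sol4.z : Sol4 D → ℂ) :=
  (continuous_snd.comp continuous_snd).comp (Sol4.coordsHomeomorph D).continuous

theorem Sol6.continuous_t : Continuous (Sol6.t : Sol6 D → ℝ) :=
  continuous_fst.comp (Sol6.coordsHomeomorph D).continuous
theorem Sol6.continuous_u : Continuous (Sol6.u : Sol6 D → ℝ) :=
  (continuous_fst.comp continuous_snd).comp (Sol6.coordsHomeomorph D).continuous
theorem Sol6.continuous_z : Continuous (Sol6.z : Sol6 D → ℂ) :=
  (continuous_fst.comp (continuous_snd.comp continuous_snd)).comp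
    (Sol6.coordsHomeomorph D).continuous
theorem Sol6.continuous_w : Continuous (Sol6.w : Sol6 D → ℂ) :=
  (continuous_snd.comp (continuous_snd.comp continuous_snd)).comp
    (Sol6.coordsHomeomorph D).continuous

instance : IsTopologicalGroup (Sol4 D) where
  continuous_mul := by
    have ht := Sol4.continuous_t D
    have hu := Sol4.continuous_u D
    have hz := Sol4.continuous_z D
    refine (Sol4.coordsHomeomorph D).isInducing.continuous_iff.2 ?_
    refine Continuous.prodMk ?_ (Continuous.prodMk ?_ ?_)
    · exact (ht.comp continuous_fst).add (ht.comp continuous_snd)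
    · exact ((D.continuous_rpow.comp (ht.comp continuous_fst)).mul (hu.comp continuous_snd)).add
        (hu.comp continuous_fst)
    · exact ((D.continuous_cpow.comp (ht.comp continuous_fst)).mul (hz.comp continuous_snd)).add
        (hz.comp continuous_fst)
  continuous_inv := by
    have ht := (Sol4.continuous_t D).neg
    refine (Sol4.coordsHomeomorph D).isInducing.continuous_iff.2 ?_
    refine Continuous.prodMk ht (Continuous.prodMk ?_ ?_)
    · exact ((D.continuous_rpow.comp ht).mul (Sol4.continuous_u D)).neg
    · have h : Continuous fun p : Sol4 D => D.α ^ (-(p.t : ℂ)) :=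
        (D.continuous_cpow.comp ht).congr fun p => by simp
      exact (h.mul (Sol4.continuous_z D)).neg

instance : IsTopologicalGroup (Sol6 D) where
  continuous_mul := by
    have ht := Sol6.continuous_t D
    have hu := Sol6.continuous_u D
    have hz := Sol6.continuous_z D
    have hw := Sol6.continuous_w D
    refine (Sol6.coordsHomeomorph D).isInducing.continuous_iff.2 ?_
    refine Continuous.prodMk ?_ (Continuous.prodMk ?_ (Continuous.prodMk ?_ ?_))
    · exact (ht.comp continuous_fst).add (ht.comp continuous_snd)
    · exact ((D.continuous_rpow.comp (ht.comp continuous_fst)).mul (hu.comp continuous_snd)).add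
        (hu.comp continuous_fst)
    · exact ((D.continuous_cpow.comp (ht.comp continuous_fst)).mul (hz.comp continuous_snd)).add
        (hz.comp continuous_fst)
    · exact ((continuous_quarterRotation.comp (ht.comp continuous_fst)).mul
        (hw.comp continuous_snd)).add (hw.comp continuous_fst)
  continuous_inv := by
    have ht := (Sol6.continuous_t D).neg
    refine (Sol6.coordsHomeomorph D).isInducing.continuous_iff.2 ?_
    refine Continuous.prodMk ht (Continuous.prodMk ?_ (Continuous.prodMk ?_ ?_))
    · exact ((D.continuous_rpow.comp ht).mul (Sol6.continuous_u D)).neg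
    · have h : Continuous fun p : Sol6 D => D.α ^ (-(p.t : ℂ)) :=
        (D.continuous_cpow.comp ht).congr fun p => by simp
      exact (h.mul (Sol6.continuous_z D)).neg
    · exact ((continuous_quarterRotation.comp ht).mul (Sol6.continuous_w D)).neg

theorem continuous_forgetHom : Continuous (forgetHom D) :=
  (Sol4.coordsHomeomorph D).isInducing.continuous_iff.2 <|
    (Sol6.continuous_t D).prodMk ((Sol6.continuous_u D).prodMk (Sol6.continuous_z D))

/-- The section `w = 0` of the projection of groups. -/
def zeroSection (p : Sol4 D) : Sol6 D := ⟨p.t, p.u, p.z, 0⟩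

theorem continuous_zeroSection : Continuous (zeroSection D) :=
  (Sol6.coordsHomeomorph D).isInducing.continuous_iff.2 <|
    (Sol4.continuous_t D).prodMk ((Sol4.continuous_u D).prodMk ((Sol4.continuous_z D).prodMk
      continuous_const))

/-- The coordinates in which the points of the lattice `Γ` are integral. -/
noncomputable def latticeCoords (p : Sol6 D) : ℝ × (Fin 3 → ℝ) × ℝ × ℝ :=
  (p.t, D.latticeEquiv.symm (p.u, p.z), p.w.re, p.w.im)

theorem continuous_latticeCoords : Continuous (latticeCoords D) :=
  (Sol6.continuous_t D).prodMk
    ((D.latticeEquiv.symm.continuous.comp ((Sol6.continuous_u D).prodMk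
      (Sol6.continuous_z D))).prodMk
      ((Complex.continuous_re.comp (Sol6.continuous_w D)).prodMk
        (Complex.continuous_im.comp (Sol6.continuous_w D))))

theorem latticeCoords_injective : Function.Injective (latticeCoords D) := by
  intro p q h
  simp only [latticeCoords, Prod.mk.injEq, EmbeddingLike.apply_eq_iff_eq] at h
  obtain ⟨ht, ⟨hu, hz⟩, hr, hi⟩ := h
  exact Sol6.ext ht hu hz (Complex.ext hr hi)

/-- In lattice coordinates the points of `Γ` are integral, and a compact set becomes bounded. -/
theorem finite_Gamma6_inter_of_isCompact {K : Set (Sol6 D)} (hK : IsCompact K) :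
    ((Gamma6 D : Set (Sol6 D)) ∩ K).Finite := by
  obtain ⟨R, hR⟩ := (hK.image (continuous_latticeCoords D)).isBounded.exists_norm_le
  let box : Set (ℤ × (Fin 3 → ℤ) × ℤ × ℤ) := Set.Icc (-⌈R⌉) ⌈R⌉ ×ˢ
    Set.Icc (fun _ => -⌈R⌉) (fun _ => ⌈R⌉) ×ˢ Set.Icc (-⌈R⌉) ⌈R⌉ ×ˢ Set.Icc (-⌈R⌉) ⌈R⌉
  let cast : ℤ × (Fin 3 → ℤ) × ℤ × ℤ → ℝ × (Fin 3 → ℝ) × ℝ × ℝ :=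
    fun x => (x.1, fun j => x.2.1 j, x.2.2.1, x.2.2.2)
  have hfin : (cast '' box).Finite := ((Set.finite_Icc _ _).prod
    ((Set.finite_Icc _ _).prod ((Set.finite_Icc _ _).prod (Set.finite_Icc _ _)))).image _
  refine Set.Finite.of_finite_image (f := latticeCoords D) (hfin.subset ?_)
    (latticeCoords_injective D).injOn
  rintro _ ⟨g, ⟨hg, hgK⟩, rfl⟩
  have hn := hR _ ⟨g, hgK, rfl⟩
  obtain ⟨n, k, hn', hk, hw⟩ := exists_of_mem_Gamma6 D hg
  obtain ⟨a, b, hab⟩ := mem_gaussianSubring.1 hw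
  have hcoords : latticeCoords D g = cast (n, k, a, b) := by
    simp [latticeCoords, cast, hn', hk, hab, InoueData.latticePoint]
  refine ⟨(n, k, a, b), ?_, hcoords.symm⟩
  rw [hcoords] at hn
  simp only [cast, norm_prod_le_iff] at hn
  obtain ⟨h1, h2, h3, h4⟩ := hn
  have bound : ∀ x : ℤ, ‖(x : ℝ)‖ ≤ R → -⌈R⌉ ≤ x ∧ x ≤ ⌈R⌉ := fun x hx => by
    have := (abs_le.1 (hx.trans (Int.le_ceil R)))
    exact ⟨by exact_mod_cast this.1, by exact_mod_cast this.2⟩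
  have h2' := fun j => bound _ ((norm_le_pi_norm (fun j => (k j : ℝ)) j).trans h2)
  exact ⟨bound _ h1, ⟨fun j => (h2' j).1, fun j => (h2' j).2⟩, bound _ h3, bound _ h4⟩

/-- Lift to `Γ` and remove the `w`-coordinate, a Gaussian integer, by a fibre translation. This
transfers discreteness from `Γ` to `Γ₁`. -/
theorem zeroSection_mem {g : Sol4 D} (hg : g ∈ Gamma4 D) : zeroSection D g ∈ Gamma6 D := by
  rw [← Gamma6_map_forgetHom] at hg
  obtain ⟨x, hx, rfl⟩ := hg
  obtain ⟨-, -, -, -, hw⟩ := exists_of_mem_Gamma6 D hx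
  have : zeroSection D (forgetHom D x) = ⟨0, 0, 0, -x.w⟩ * x := by
    ext <;> simp [zeroSection, forgetHom, Sol6.mul_def, quarterRotation_zero]
  rw [this]
  exact mul_mem (fiberTranslation_mem D (neg_mem hw)) hx

theorem finite_Gamma4_inter_of_isCompact {K : Set (Sol4 D)} (hK : IsCompact K) :
    ((Gamma4 D : Set (Sol4 D)) ∩ K).Finite := by
  refine Set.Finite.of_finite_image (f := zeroSection D)
    ((finite_Gamma6_inter_of_isCompact D (hK.image (continuous_zeroSection D))).subset ?_)
    (fun p _ q _ h => ?_)
  · rintro _ ⟨g, ⟨hg, hgK⟩, rfl⟩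
    exact ⟨zeroSection_mem D hg, g, hgK, rfl⟩
  · exact congrArg (forgetHom D) h

theorem Subgroup.properlyDiscontinuousSMul_of_finite_inter {G : Type*} [Group G]
    [TopologicalSpace G] [IsTopologicalGroup G] (S : Subgroup G)
    (h : ∀ K : Set G, IsCompact K → ((S : Set G) ∩ K).Finite) : ProperlyDiscontinuousSMul S G := by
  refine S.properlyDiscontinuousSMul_of_tendsto_cofinite ?_
  rw [(Filter.hasBasis_cocompact).tendsto_right_iff]
  intro K hK
  have := (h K hK).preimage (f := (Subtype.val : S → G)) Subtype.val_injective.injOn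
  rw [Filter.eventually_cofinite]
  refine this.subset fun x hx => ⟨x.2, ?_⟩
  simpa using hx

instance : ProperlyDiscontinuousSMul (Gamma6 D) (Sol6 D) :=
  (Gamma6 D).properlyDiscontinuousSMul_of_finite_inter
    fun _ => finite_Gamma6_inter_of_isCompact D

instance : ProperlyDiscontinuousSMul (Gamma4 D) (Sol4 D) :=
  (Gamma4 D).properlyDiscontinuousSMul_of_finite_inter
    fun _ => finite_Gamma4_inter_of_isCompact D

theorem t2Space_M6 : T2Space (M6 D) :=
  inferInstanceAs (T2Space (Quotient (MulAction.orbitRel (Gamma6 D) (Sol6 D))))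

theorem t2Space_M4 : T2Space (M4 D) :=
  inferInstanceAs (T2Space (Quotient (MulAction.orbitRel (Gamma4 D) (Sol4 D))))

theorem isQuotientCoveringMap_M6_mk : IsQuotientCoveringMap (M6.mk D) (Gamma6 D) :=
  isQuotientCoveringMap_quotientMk_of_properlyDiscontinuousSMul

theorem isQuotientCoveringMap_M4_mk : IsQuotientCoveringMap (M4.mk D) (Gamma4 D) :=
  isQuotientCoveringMap_quotientMk_of_properlyDiscontinuousSMul

theorem M6.mk_eq_iff (p q : Sol6 D) : M6.mk D p = M6.mk D q ↔ ∃ γ ∈ Gamma6 D, γ * q = p := by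
  rw [(isQuotientCoveringMap_M6_mk D).apply_eq_iff_mem_orbit]
  exact ⟨fun ⟨γ, h⟩ => ⟨γ, γ.2, h⟩, fun ⟨γ, hγ, h⟩ => ⟨⟨γ, hγ⟩, h⟩⟩

theorem M4.mk_eq_iff (p q : Sol4 D) : M4.mk D p = M4.mk D q ↔ ∃ γ ∈ Gamma4 D, γ * q = p := by
  rw [(isQuotientCoveringMap_M4_mk D).apply_eq_iff_mem_orbit]
  exact ⟨fun ⟨γ, h⟩ => ⟨γ, γ.2, h⟩, fun ⟨γ, hγ, h⟩ => ⟨⟨γ, hγ⟩, h⟩⟩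

/-- The unit cube in lattice coordinates surjects onto the quotient. -/
theorem compactSpace_M6 : CompactSpace (M6 D) := by
  let box : Set (ℝ × (Fin 3 → ℝ) × ℝ × ℝ) := Set.Icc 0 1
  let φ : ℝ × (Fin 3 → ℝ) × ℝ × ℝ → M6 D := fun x =>
    M6.mk D ⟨x.1, (D.latticeEquiv x.2.1).1, (D.latticeEquiv x.2.1).2,
      x.2.2.1 + x.2.2.2 * Complex.I⟩
  have hφ : Continuous φ := by
    refine (isQuotientCoveringMap_M6_mk D).continuous.comp ?_
    refine (Sol6.coordsHomeomorph D).isInducing.continuous_iff.2 ?_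
    have h := D.latticeEquiv.continuous
    refine Continuous.prodMk (by fun_prop) (Continuous.prodMk ?_ (Continuous.prodMk ?_ ?_))
    · exact continuous_fst.comp (h.comp (continuous_fst.comp continuous_snd))
    · exact continuous_snd.comp (h.comp (continuous_fst.comp continuous_snd))
    · change Continuous fun x : ℝ × (Fin 3 → ℝ) × ℝ × ℝ =>
        (x.2.2.1 : ℂ) + (x.2.2.2 : ℂ) * Complex.I
      fun_prop
  have hsurj : φ '' box = Set.univ := by
    refine Set.eq_univ_of_forall fun x => ?_
    obtain ⟨p, rfl⟩ := (isQuotientCoveringMap_M6_mk D).surjective x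
    -- A power of `g₀` brings `t` into `[0, 1)`. Lattice translations then adjust the other
    -- coordinates without moving `t`; the order matters, as `g₀` changes `u`, `z` and `w`.
    set q := g0 D ^ (-⌊p.t⌋) * p with hq
    have hqt : q.t = Int.fract p.t := by
      rw [hq, g0_zpow, Sol6.mul_def, Int.fract]; push_cast; ring
    let r := D.latticeEquiv.symm (q.u, q.z)
    have hr : D.latticeEquiv r = (q.u, q.z) := D.latticeEquiv.apply_symm_apply _
    let k : Fin 3 → ℤ := fun j => -⌊r j⌋
    let w : ℂ := (-⌊q.w.re⌋ : ℤ) + (-⌊q.w.im⌋ : ℤ) * Complex.I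
    have hw : w ∈ gaussianSubring := mem_gaussianSubring.2 ⟨_, _, rfl⟩
    refine ⟨(Int.fract p.t, fun j => Int.fract (r j), Int.fract q.w.re, Int.fract q.w.im), ?_, ?_⟩
    · exact ⟨⟨Int.fract_nonneg _, fun j => Int.fract_nonneg _, Int.fract_nonneg _,
        Int.fract_nonneg _⟩, ⟨(Int.fract_lt_one _).le, fun j => (Int.fract_lt_one _).le,
        (Int.fract_lt_one _).le, (Int.fract_lt_one _).le⟩⟩
    · refine (M6.mk_eq_iff D _ _).2 ⟨⟨0, (D.latticePoint k).1, (D.latticePoint k).2, w⟩ *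
        g0 D ^ (-⌊p.t⌋), mul_mem (latticeTranslation_mem D k hw) (zpow_mem (g0_mem D) _), ?_⟩
      rw [mul_assoc, ← hq]
      have hfr : D.latticeEquiv (fun j => Int.fract (r j)) = (q.u, q.z) + D.latticePoint k := by
        rw [← hr, InoueData.latticePoint, ← map_add]
        congr 1; ext j; simp [k, Int.fract, sub_eq_add_neg]
      have hfr' : D.latticeEquiv (fun j => Int.fract (r j)) =
          (q.u + (D.latticePoint k).1, q.z + (D.latticePoint k).2) := hfr
      simp only [hfr']
      ext
      · simp [Sol6.mul_def, hqt]
      · simp [Sol6.mul_def]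
      · simp [Sol6.mul_def]
      · apply Complex.ext <;> simp [Sol6.mul_def, quarterRotation_zero, w, -Int.self_sub_floor,
          Int.fract, add_comm, sub_eq_add_neg]
  exact ⟨hsurj ▸ (isCompact_Icc.image hφ)⟩

theorem continuous_forgetW : Continuous (forgetW D) := by
  rw [(isQuotientCoveringMap_M6_mk D).toIsQuotientMap.continuous_iff]
  exact (isQuotientCoveringMap_M4_mk D).continuous.comp (continuous_forgetHom D)

theorem surjective_forgetW : Function.Surjective (forgetW D) := fun x => by
  obtain ⟨p, rfl⟩ := (isQuotientCoveringMap_M4_mk D).surjective x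
  exact ⟨M6.mk D (zeroSection D p), rfl⟩

theorem compactSpace_M4 : CompactSpace (M4 D) :=
  haveI := compactSpace_M6 D
  (surjective_forgetW D).compactSpace (continuous_forgetW D)

theorem isCoveringMap_M6_proj : IsCoveringMap (M6.proj D) :=
  (isQuotientCoveringMap_M6_mk D).isCoveringMap.comp_homeomorph (Sol6.coordsHomeomorph D).symm

theorem isCoveringMap_M4_proj : IsCoveringMap (M4.proj D) :=
  (isQuotientCoveringMap_M4_mk D).isCoveringMap.comp_homeomorph (Sol4.coordsHomeomorph D).symm

theorem surjective_M6_proj : Function.Surjective (M6.proj D) :=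
  (isQuotientCoveringMap_M6_mk D).surjective.comp (Sol6.coords D).symm.surjective

theorem surjective_M4_proj : Function.Surjective (M4.proj D) :=
  (isQuotientCoveringMap_M4_mk D).surjective.comp (Sol4.coords D).symm.surjective

end SolvableTopology

/-! ### Smooth structure on the base of a covering -/

section QuotientManifold

open Filter Topology

variable {𝕜 E H M X : Type*} [NontriviallyNormedField 𝕜] [NormedAddCommGroup E] [NormedSpace 𝕜 E]
  [TopologicalSpace H] {I : ModelWithCorners 𝕜 E H} {n : ℕ∞ω} [TopologicalSpace M]
  [ChartedSpace H M] [TopologicalSpace X]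

theorem mem_contDiffGroupoid_of_contMDiffOn {φ : OpenPartialHomeomorph H H}
    (h : ContMDiffOn I I n φ φ.source) (h' : ContMDiffOn I I n φ.symm φ.target) :
    φ ∈ contDiffGroupoid n I := by
  have h1 := φ.mem_maximalAtlas_of_contMDiffOn h h'
  have h2 : chartAt H (M := H) = fun _ => OpenPartialHomeomorph.refl H := rfl
  have h3 : OpenPartialHomeomorph.refl H ∈ IsManifold.maximalAtlas I n H :=
    StructureGroupoid.subset_maximalAtlas _ (by simp)
  have h4 := StructureGroupoid.compatible_of_mem_maximalAtlas h3 h1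
  simpa using h4

variable {f : M → X}

/-- If points of `M` in the same fibre of a local homeomorphism `f` are related by smooth
deck transformations, then transitions between local inverses of `f` are smooth. -/
theorem IsLocalHomeomorph.contMDiffAt_localInverseAt_comp (hf : IsLocalHomeomorph f)
    (hdeck : ∀ a b, f a = f b → ∃ γ : M → M, ContMDiff I I n γ ∧ γ a = b ∧ ∀ x, f (γ x) = f x)
    {a m : M} (hm : f m ∈ (hf.localInverseAt a).source) :
    ContMDiffAt I I n (hf.localInverseAt a ∘ f) m := by
  set g := hf.localInverseAt a
  obtain ⟨γ, hγ, hγm, hfγ⟩ := hdeck m (g (f m)) (hf.apply_localInverseAt_of_mem hm).symm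
  refine (hγ m).congr_of_eventuallyEq ?_
  -- Near `m`, `γ` takes values where `g` inverts `f`, so `g ∘ f` coincides there with `γ`.
  have : γ ⁻¹' g.target ∈ 𝓝 m :=
    hγ.continuous.continuousAt (g.open_target.mem_nhds (by rw [hγm]; exact g.map_source hm))
  filter_upwards [this] with x hx
  have h := g.right_inv hx
  rw [hf.localInverseAt_symm, hfγ] at h
  exact h

/-- A transition is a local inverse after `f`, between two charts of `M`, hence locally a deck
transformation read in charts. -/
theorem IsLocalHomeomorph.isManifold_chartedSpace [IsManifold I n M] (hf : IsLocalHomeomorph f)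
    (hsurj : Function.Surjective f)
    (hdeck : ∀ a b, f a = f b → ∃ γ : M → M, ContMDiff I I n γ ∧ γ a = b ∧ ∀ x, f (γ x) = f x) :
    letI := hf.chartedSpace (H := H) hsurj
    IsManifold I n X := by
  let := hf.chartedSpace (H := H) hsurj
  have key : ∀ a b : M, ContMDiffOn I I n
      (((hf.localInverseAt a).trans (chartAt H a)).symm.trans
        ((hf.localInverseAt b).trans (chartAt H b)))
      (((hf.localInverseAt a).trans (chartAt H a)).symm.trans
        ((hf.localInverseAt b).trans (chartAt H b))).source := by
    intro a b y hy
    refine ContMDiffAt.contMDiffWithinAt ?_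
    simp only [OpenPartialHomeomorph.trans_source, OpenPartialHomeomorph.symm_source,
      OpenPartialHomeomorph.trans_target, OpenPartialHomeomorph.coe_trans_symm,
      hf.localInverseAt_symm, Set.mem_inter_iff, Set.mem_preimage, Function.comp_apply] at hy
    obtain ⟨⟨hy1, -⟩, hy3, hy4⟩ := hy
    have h1 : ContMDiffAt I I n (chartAt H a).symm y :=
      contMDiffOn_chart_symm.contMDiffAt ((chartAt H a).open_target.mem_nhds hy1)
    have h2 := hf.contMDiffAt_localInverseAt_comp hdeck hy3
    have h3 : ContMDiffAt I I n (chartAt H b) (hf.localInverseAt b (f ((chartAt H a).symm y))) :=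
      contMDiffOn_chart.contMDiffAt ((chartAt H b).open_source.mem_nhds hy4)
    have := (ContMDiffAt.comp _ (g := chartAt H b) (f := hf.localInverseAt b ∘ f) h3 h2).comp y h1
    convert this using 1
    ext x
    simp
  refine { compatible := ?_ }
  rintro _ _ ⟨q, rfl⟩ ⟨q', rfl⟩
  refine mem_contDiffGroupoid_of_contMDiffOn (key _ _) ?_
  -- The inverse of a transition is the transition with the base points exchanged.
  have := key (hsurj.hasRightInverse.choose q') (hsurj.hasRightInverse.choose q)
  rw [← OpenPartialHomeomorph.symm_source, OpenPartialHomeomorph.trans_symm_eq_symm_trans_symm,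
    OpenPartialHomeomorph.symm_symm]
  exact this

theorem IsLocalHomeomorph.isLocalDiffeomorph_chartedSpace [IsManifold I n M]
    (hf : IsLocalHomeomorph f) (hsurj : Function.Surjective f)
    (hdeck : ∀ a b, f a = f b → ∃ γ : M → M, ContMDiff I I n γ ∧ γ a = b ∧ ∀ x, f (γ x) = f x) :
    letI := hf.chartedSpace (H := H) hsurj
    IsLocalDiffeomorph I I n f := by
  let := hf.chartedSpace (H := H) hsurj
  have : IsManifold I n X := hf.isManifold_chartedSpace hsurj hdeck
  have hchart : ∀ q : X, ∃ a : M, chartAt H q = (hf.localInverseAt a).trans (chartAt H a) :=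
    fun q => ⟨_, rfl⟩
  have hfs : ContMDiff I I n f := by
    intro m
    obtain ⟨a, ha⟩ := hchart (f m)
    have hm : f m ∈ (chartAt H (f m)).source := mem_chart_source H (f m)
    have hm' := hm
    rw [ha, OpenPartialHomeomorph.trans_source] at hm'
    have h1 := hf.contMDiffAt_localInverseAt_comp hdeck hm'.1
    have h2 : ContMDiffAt I I n (chartAt H a) (hf.localInverseAt a (f m)) :=
      contMDiffOn_chart.contMDiffAt ((chartAt H a).open_source.mem_nhds hm'.2)
    have h3 : ContMDiffAt I I n (chartAt H (f m)).symm (chartAt H (f m) (f m)) :=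
      contMDiffOn_chart_symm.contMDiffAt ((chartAt H (f m)).open_target.mem_nhds
        ((chartAt H (f m)).map_source hm))
    have h4 : ContMDiffAt I I n (chartAt H (f m) ∘ f) m := by
      rw [ha]
      exact ContMDiffAt.comp m (g := chartAt H a) (f := hf.localInverseAt a ∘ f) h2 h1
    refine (ContMDiffAt.comp m (g := (chartAt H (f m)).symm) h3 h4).congr_of_eventuallyEq ?_
    filter_upwards [hf.continuous.continuousAt ((chartAt H (f m)).open_source.mem_nhds hm)] with x hx
    exact ((chartAt H (f m)).left_inv hx).symm
  intro m
  -- The chart at `x` may use a different local inverse. Going up by it and then applying `g ∘ f`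
  -- recovers `g`.
  let g := hf.localInverseAt m
  have hgs : ContMDiffOn I I n g g.source := by
    intro x hx
    refine ContMDiffAt.contMDiffWithinAt ?_
    obtain ⟨a, ha⟩ := hchart x
    have hxs : x ∈ (chartAt H x).source := mem_chart_source H x
    have hx' := hxs
    rw [ha, OpenPartialHomeomorph.trans_source] at hx'
    have h1 : ContMDiffAt I I n (chartAt H x) x :=
      contMDiffOn_chart.contMDiffAt ((chartAt H x).open_source.mem_nhds hxs)
    have h2 : ContMDiffAt I I n (chartAt H a).symm (chartAt H x x) := by
      refine contMDiffOn_chart_symm.contMDiffAt ((chartAt H a).open_target.mem_nhds ?_)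
      rw [ha]; exact (chartAt H a).map_source hx'.2
    have e1 : ∀ y ∈ (chartAt H x).source, (chartAt H a).symm (chartAt H x y) =
        hf.localInverseAt a y := fun y hy => by
      rw [ha, OpenPartialHomeomorph.trans_source] at hy
      rw [ha]; exact (chartAt H a).left_inv hy.2
    have e2 : ∀ y ∈ (chartAt H x).source, f ((chartAt H a).symm (chartAt H x y)) = y :=
      fun y hy => by
        rw [e1 y hy]
        rw [ha, OpenPartialHomeomorph.trans_source] at hy
        exact hf.apply_localInverseAt_of_mem hy.1
    have h3 : ContMDiffAt I I n (g ∘ f) ((chartAt H a).symm (chartAt H x x)) :=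
      hf.contMDiffAt_localInverseAt_comp hdeck (by rw [e2 x hxs]; exact hx)
    refine (h3.comp x (h2.comp x h1)).congr_of_eventuallyEq ?_
    filter_upwards [(chartAt H x).open_source.mem_nhds hxs] with y hy
    simp only [Function.comp_apply, e2 y hy]
  refine ⟨{ toPartialEquiv := g.symm.toPartialEquiv
            open_source := g.open_target
            open_target := g.open_source
            contMDiffOn_toFun := ?_
            contMDiffOn_invFun := hgs }, hf.self_mem_localInverseAt_target, fun x _ => ?_⟩
  · have : (g.symm.toPartialEquiv : M → X) = f := hf.localInverseAt_symm m
    rw [this]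
    exact hfs.contMDiffOn
  · exact (congrFun (hf.localInverseAt_symm m) x).symm

end QuotientManifold

/-! ### Descent of smoothness along local diffeomorphisms -/

section Descent

open Filter Topology

variable {𝕜 E H M E' H' X E'' H'' N : Type*} [NontriviallyNormedField 𝕜]
  [NormedAddCommGroup E] [NormedSpace 𝕜 E] [TopologicalSpace H] {I : ModelWithCorners 𝕜 E H}
  [NormedAddCommGroup E'] [NormedSpace 𝕜 E'] [TopologicalSpace H'] {I' : ModelWithCorners 𝕜 E' H'}
  [NormedAddCommGroup E''] [NormedSpace 𝕜 E''] [TopologicalSpace H'']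
  {J : ModelWithCorners 𝕜 E'' H''} {n : ℕ∞ω}
  [TopologicalSpace M] [ChartedSpace H M] [TopologicalSpace X] [ChartedSpace H' X]
  [TopologicalSpace N] [ChartedSpace H'' N] {f : M → X}

/-- Near `f m`, `F` is `F ∘ f` after a local inverse of `f`. -/
theorem IsLocalDiffeomorphAt.contMDiffAt_of_comp {m : M} (hf : IsLocalDiffeomorphAt I I' n f m)
    {F : X → N} (hF : ContMDiffAt I J n (F ∘ f) m) : ContMDiffAt I' J n F (f m) := by
  have h1 := hf.localInverse_contMDiffAt
  have h2 : hf.localInverse (f m) = m := hf.localInverse_left_inv hf.localInverse_mem_target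
  rw [← h2] at hF
  refine (hF.comp (f m) h1).congr_of_eventuallyEq ?_
  filter_upwards [hf.localInverse_eventuallyEq_right] with y hy
  exact (congrArg F hy).symm

theorem IsLocalDiffeomorph.contMDiff_of_comp (hf : IsLocalDiffeomorph I I' n f)
    (hsurj : Function.Surjective f) {F : X → N} (hF : ContMDiff I J n (F ∘ f)) :
    ContMDiff I' J n F := fun x => by
  obtain ⟨m, rfl⟩ := hsurj x
  exact (hf m).contMDiffAt_of_comp (hF m)

end Descent

/-! ### Deck transformations in coordinates and the first Betti number -/

section DeckTransformations

open Filter Topology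

variable (D : InoueData)

/-- Left translations of the six-dimensional group are affine in the coordinates. -/
noncomputable def leftTranslation6 : Sol6 D →* ((ℝ × ℝ × ℂ × ℂ) →ᵃ[ℝ] (ℝ × ℝ × ℂ × ℂ)) where
  toFun g :=
    { toFun := fun x => Sol6.coords D (g * (Sol6.coords D).symm x)
      linear := LinearMap.prodMap LinearMap.id (LinearMap.prodMap (D.c ^ g.t • LinearMap.id)
        (LinearMap.prodMap (LinearMap.mulLeft ℝ (D.α ^ (g.t : ℂ)))
          (LinearMap.mulLeft ℝ (quarterRotation g.t))))
      map_vadd' := fun x v => by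
        refine Prod.ext ?_ (Prod.ext ?_ (Prod.ext ?_ ?_)) <;>
          simp [Sol6.coords, Sol6.mul_def] <;> ring }
  map_one' := by
    ext1 x
    simp
  map_mul' g h := by
    ext1 x
    simp [mul_assoc]

/-- The action of `Γ` on the coordinate space by affine automorphisms. -/
noncomputable def deckHom6 :
    Gamma6 D →* ((ℝ × ℝ × ℂ × ℂ) ≃ᵃ[ℝ] (ℝ × ℝ × ℂ × ℂ)) :=
  (AffineEquiv.equivUnitsAffineMap.symm.toMonoidHom.comp
    (leftTranslation6 D).toHomUnits).comp (Gamma6 D).subtype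

theorem deckHom6_apply (γ : Gamma6 D) (x : ℝ × ℝ × ℂ × ℂ) :
    deckHom6 D γ x = Sol6.coords D ((γ : Sol6 D) * (Sol6.coords D).symm x) := rfl

theorem M6.proj_eq_iff (a b : ℝ × ℝ × ℂ × ℂ) :
    M6.proj D a = M6.proj D b ↔ ∃ γ : Gamma6 D, deckHom6 D γ b = a := by
  refine (M6.mk_eq_iff D _ _).trans ⟨?_, ?_⟩
  · rintro ⟨γ, hγ, h⟩
    exact ⟨⟨γ, hγ⟩, by rw [deckHom6_apply]; exact (congrArg _ h).trans (Equiv.apply_symm_apply _ _)⟩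
  · rintro ⟨γ, h⟩
    refine ⟨γ, γ.2, ?_⟩
    rw [← h, deckHom6_apply, Equiv.symm_apply_apply]

theorem firstBettiNumber_M6 : firstBettiNumber (M6 D) = 1 := by
  have hp := isCoveringMap_M6_proj D
  refine firstBettiNumber_eq_one_of_covering (p := ⟨M6.proj D, hp.continuous⟩) hp
    (surjective_M6_proj D) (deckHom6 D) (M6.proj_eq_iff D) (timeHom D) (fun x => x.1)
    (fun γ x => ?_) _ (timeHom_g0 D) _ (two_mul_det_ne_zero D) (abelianization_Gamma6 D)
  rw [timeHom_cast, add_comm]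
  rfl

theorem contDiff_left_mul_Sol4 (g : Sol4 D) :
    ContDiff ℝ ∞ fun x => Sol4.coords D (g * (Sol4.coords D).symm x) := by
  change ContDiff ℝ ∞ fun x : ℝ × ℝ × ℂ =>
    (g.t + x.1, D.c ^ g.t * x.2.1 + g.u, D.α ^ (g.t : ℂ) * x.2.2 + g.z)
  fun_prop

theorem M6.exists_deck (a b : ℝ × ℝ × ℂ × ℂ) (h : M6.proj D a = M6.proj D b) :
    ∃ γ : ℝ × ℝ × ℂ × ℂ → ℝ × ℝ × ℂ × ℂ,
      ContMDiff 𝓘(ℝ, ℝ × ℝ × ℂ × ℂ) 𝓘(ℝ, ℝ × ℝ × ℂ × ℂ) ∞ γ ∧ γ a = b ∧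
        ∀ x, M6.proj D (γ x) = M6.proj D x := by
  obtain ⟨γ, hγ⟩ := (M6.proj_eq_iff D b a).1 h.symm
  refine ⟨deckHom6 D γ, ?_, hγ, fun x => (M6.proj_eq_iff D _ _).2 ⟨γ, rfl⟩⟩
  have := (⟨(deckHom6 D γ).toAffineMap,
    (deckHom6 D γ).toAffineMap.continuous_of_finiteDimensional⟩ :
    (ℝ × ℝ × ℂ × ℂ) →ᴬ[ℝ] (ℝ × ℝ × ℂ × ℂ)).contDiff (n := ∞)
  exact this.contMDiff

theorem M4.proj_eq_iff (a b : ℝ × ℝ × ℂ) : M4.proj D a = M4.proj D b ↔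
    ∃ γ ∈ Gamma4 D, Sol4.coords D (γ * (Sol4.coords D).symm b) = a := by
  refine (M4.mk_eq_iff D _ _).trans ?_
  simp only [Equiv.eq_symm_apply]

theorem M4.exists_deck (a b : ℝ × ℝ × ℂ) (h : M4.proj D a = M4.proj D b) :
    ∃ γ : ℝ × ℝ × ℂ → ℝ × ℝ × ℂ, ContMDiff 𝓘(ℝ, ℝ × ℝ × ℂ) 𝓘(ℝ, ℝ × ℝ × ℂ) ∞ γ ∧ γ a = b ∧
      ∀ x, M4.proj D (γ x) = M4.proj D x := by
  obtain ⟨γ, hγ, hγa⟩ := (M4.proj_eq_iff D b a).1 h.symm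
  exact ⟨_, (contDiff_left_mul_Sol4 D γ).contMDiff, hγa,
    fun x => (M4.proj_eq_iff D _ _).2 ⟨γ, hγ, rfl⟩⟩

end DeckTransformations

/-! ### Identification of `M⁴` with the Inoue surface -/

section UpperHalfPlane

open Filter Topology

instance : IsManifold 𝓘(ℝ, ℂ) ∞ ℍ := UpperHalfPlane.isOpenEmbedding_coe.isManifold_singleton

theorem UpperHalfPlane.contMDiff_coe_real :
    ContMDiff 𝓘(ℝ, ℂ) 𝓘(ℝ, ℂ) ∞ ((↑) : ℍ → ℂ) := fun _ => contMDiffAt_extChartAt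

theorem UpperHalfPlane.contMDiff_of_coe {E H M : Type*} [NormedAddCommGroup E] [NormedSpace ℝ E]
    [TopologicalSpace H] {I : ModelWithCorners ℝ E H} [TopologicalSpace M] [ChartedSpace H M]
    {f : M → ℍ} (hf : ContMDiff I 𝓘(ℝ, ℂ) ∞ fun x => (f x : ℂ)) : ContMDiff I 𝓘(ℝ, ℂ) ∞ f :=
  fun x => contMDiffAt_iff_target.2
    ⟨(UpperHalfPlane.isOpenEmbedding_coe.isInducing.continuous_iff.2 hf.continuous).continuousAt,
      hf x⟩

variable (D : InoueData)

theorem InoueData.log_c_pos : 0 < Real.log D.c := Real.log_pos D.one_lt_c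

/-- The identification of the four-dimensional group with `ℍ × ℂ`. -/
noncomputable def sol4EquivUpperHalf : Sol4 D ≃ ℍ × ℂ where
  toFun := sol4ToUpperHalf D
  invFun x := ⟨Real.log x.1.im / Real.log D.c, x.1.re, x.2⟩
  left_inv p := by
    have h := D.log_c_pos.ne'
    ext
    · change Real.log (D.c ^ p.t) / Real.log D.c = p.t
      rw [Real.log_rpow D.c_pos, mul_div_assoc, div_self h, mul_one]
    · rfl
    · rfl
  right_inv x := by
    refine Prod.ext (UpperHalfPlane.ext (Complex.ext rfl ?_)) rfl
    change D.c ^ (Real.log x.1.im / Real.log D.c) = x.1.im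
    rw [Real.rpow_def_of_pos D.c_pos, mul_div_cancel₀ _ D.log_c_pos.ne', Real.exp_log x.1.im_pos]

theorem contMDiff_sol4EquivUpperHalf :
    ContMDiff 𝓘(ℝ, ℝ × ℝ × ℂ) (𝓘(ℝ, ℂ).prod 𝓘(ℝ, ℂ)) ∞
      fun x => sol4EquivUpperHalf D ((Sol4.coords D).symm x) := by
  refine ContMDiff.prodMk (UpperHalfPlane.contMDiff_of_coe ?_) ?_
  · have h : ContDiff ℝ ∞ fun x : ℝ × ℝ × ℂ =>
        Complex.ofRealCLM x.2.1 + Complex.ofRealCLM (Real.exp (Real.log D.c * x.1)) * Complex.I := by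
      fun_prop
    refine h.contMDiff.congr fun x => Complex.ext ?_ ?_
    · simp [Sol4.coords, -Complex.ofReal_exp]
    · simp [Sol4.coords, -Complex.ofReal_exp,
        Real.rpow_def_of_pos D.c_pos]
  · have h : ContDiff ℝ ∞ fun x : ℝ × ℝ × ℂ => x.2.2 := by fun_prop
    exact h.contMDiff

theorem contMDiff_sol4EquivUpperHalf_symm :
    ContMDiff (𝓘(ℝ, ℂ).prod 𝓘(ℝ, ℂ)) 𝓘(ℝ, ℝ × ℝ × ℂ) ∞
      fun x => Sol4.coords D ((sol4EquivUpperHalf D).symm x) := by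
  have h1 : ContMDiff (𝓘(ℝ, ℂ).prod 𝓘(ℝ, ℂ)) 𝓘(ℝ, ℂ) ∞ fun x : ℍ × ℂ => (x.1 : ℂ) :=
    UpperHalfPlane.contMDiff_coe_real.comp contMDiff_fst
  have him : ContMDiff (𝓘(ℝ, ℂ).prod 𝓘(ℝ, ℂ)) 𝓘(ℝ, ℝ) ∞ fun x : ℍ × ℂ => x.1.im :=
    Complex.imCLM.contDiff.contMDiff.comp h1
  have hre : ContMDiff (𝓘(ℝ, ℂ).prod 𝓘(ℝ, ℂ)) 𝓘(ℝ, ℝ) ∞ fun x : ℍ × ℂ => x.1.re :=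
    Complex.reCLM.contDiff.contMDiff.comp h1
  have hlog : ContMDiff (𝓘(ℝ, ℂ).prod 𝓘(ℝ, ℂ)) 𝓘(ℝ, ℝ) ∞
      fun x : ℍ × ℂ => Real.log x.1.im / Real.log D.c := fun x => by
    have : ContDiffAt ℝ ∞ (fun r => Real.log r / Real.log D.c) x.1.im :=
      (Real.contDiffAt_log.2 x.1.im_pos.ne').div_const _
    exact this.contMDiffAt.comp x (him x)
  exact hlog.prodMk_space (hre.prodMk_space contMDiff_snd)

/-- Left translations transported to `ℍ × ℂ`. -/
noncomputable def upperHalfAction : Sol4 D →* Equiv.Perm (ℍ × ℂ) :=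
  (sol4EquivUpperHalf D).permCongrHom.toMonoidHom.comp (MulAction.toPermHom (Sol4 D) (Sol4 D))

theorem upperHalfAction_apply (g p : Sol4 D) :
    upperHalfAction D g (sol4EquivUpperHalf D p) = sol4EquivUpperHalf D (g * p) := by
  simp [upperHalfAction, Equiv.permCongrHom]

theorem upperHalfAction_eq_iff (g : Sol4 D) (σ : Equiv.Perm (ℍ × ℂ)) :
    upperHalfAction D g = σ ↔
      ∀ p, sol4ToUpperHalf D (g * p) = σ (sol4ToUpperHalf D p) := by
  refine ⟨fun h p => h ▸ (upperHalfAction_apply D g p).symm, fun h => Equiv.ext fun x => ?_⟩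
  obtain ⟨p, rfl⟩ := (sol4EquivUpperHalf D).surjective x
  exact (upperHalfAction_apply D g p).trans (h p)

/-- Generators go to generators; for `h₀` this is `c ^ (1 + t) = c · c ^ t`. -/
theorem Gamma4_map_upperHalfAction : (Gamma4 D).map (upperHalfAction D) = inoueGroup D := by
  have h0 : upperHalfAction D (h0 D) = inoueScale D := by
    rw [upperHalfAction_eq_iff]
    intro p
    refine Prod.ext (UpperHalfPlane.ext (Complex.ext ?_ ?_)) ?_
    · simp [sol4ToUpperHalf, inoueScale, h0, Sol4.mul_def]
    · simp [sol4ToUpperHalf, inoueScale, h0, Sol4.mul_def, Real.rpow_add D.c_pos]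
    · simp [sol4ToUpperHalf, inoueScale, h0, Sol4.mul_def, Units.smul_def]
  have hT : ∀ j, upperHalfAction D (hTrans D j) = inoueTrans D j := by
    intro j
    rw [upperHalfAction_eq_iff]
    intro p
    refine Prod.ext (UpperHalfPlane.ext (Complex.ext ?_ ?_)) ?_
    · simp [sol4ToUpperHalf, inoueTrans, hTrans, Sol4.mul_def, add_comm]
    · simp [sol4ToUpperHalf, inoueTrans, hTrans, Sol4.mul_def]
    · simp [sol4ToUpperHalf, inoueTrans, hTrans, Sol4.mul_def]
  rw [Gamma4, MonoidHom.map_closure, Set.image_union, Set.image_singleton, h0, ← Set.range_comp]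
  have : upperHalfAction D ∘ hTrans D = inoueTrans D := funext hT
  rw [this]
  rfl

theorem InoueSurface.mk_eq_iff (p q : Sol4 D) :
    InoueSurface.mk D (sol4EquivUpperHalf D p) = InoueSurface.mk D (sol4EquivUpperHalf D q) ↔
      ∃ γ ∈ Gamma4 D, γ * q = p := by
  refine (Quotient.eq'' (s₁ := MulAction.orbitRel (inoueGroup D) (ℍ × ℂ))).trans ?_
  rw [MulAction.orbitRel_apply]
  constructor
  · rintro ⟨⟨g, hg⟩, h⟩
    rw [← Gamma4_map_upperHalfAction] at hg
    obtain ⟨γ, hγ, rfl⟩ := hg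
    refine ⟨γ, hγ, (sol4EquivUpperHalf D).injective ?_⟩
    rw [← upperHalfAction_apply]
    exact h
  · rintro ⟨γ, hγ, rfl⟩
    refine ⟨⟨upperHalfAction D γ, ?_⟩, upperHalfAction_apply D γ q⟩
    rw [← Gamma4_map_upperHalfAction]
    exact ⟨γ, hγ, rfl⟩

/-- The identification of the four-dimensional group with `ℍ × ℂ` as a homeomorphism. -/
noncomputable def sol4HomeomorphUpperHalf : Sol4 D ≃ₜ ℍ × ℂ where
  toEquiv := sol4EquivUpperHalf D
  continuous_toFun := by
    refine ((contMDiff_sol4EquivUpperHalf D).continuous.comp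
      (Sol4.coordsHomeomorph D).continuous).congr fun p => ?_
    rfl
  continuous_invFun := (Sol4.coordsHomeomorph D).isInducing.continuous_iff.2
    (contMDiff_sol4EquivUpperHalf_symm D).continuous

/-- Pulled back along the homeomorphism with the solvable group, this becomes the quotient by `Γ₁`,
whose proper discontinuity is known. -/
theorem isCoveringMap_InoueSurface_mk : IsCoveringMap (InoueSurface.mk D) := by
  have hq : IsQuotientMap (InoueSurface.mk D) := isQuotientMap_quotient_mk'
  have hq' : IsQuotientMap (InoueSurface.mk D ∘ sol4HomeomorphUpperHalf D) :=
    hq.comp (sol4HomeomorphUpperHalf D).isQuotientMap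
  have h : IsQuotientCoveringMap (InoueSurface.mk D ∘ sol4HomeomorphUpperHalf D) (Gamma4 D) := by
    refine hq'.isQuotientCoveringMap_of_properlyDiscontinuousSMul fun {p q} => ?_
    exact (InoueSurface.mk_eq_iff D p q).trans
      ⟨fun ⟨γ, hγ, h⟩ => ⟨⟨γ, hγ⟩, h⟩, fun ⟨γ, h⟩ => ⟨γ, γ.2, h⟩⟩
  exact (IsCoveringMap.comp_homeomorph_iff _).1 h.isCoveringMap

theorem surjective_InoueSurface_mk : Function.Surjective (InoueSurface.mk D) :=
  Quotient.mk_surjective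

theorem InoueSurface.exists_deck (a b : ℍ × ℂ) (h : InoueSurface.mk D a = InoueSurface.mk D b) :
    ∃ γ : ℍ × ℂ → ℍ × ℂ,
      ContMDiff (𝓘(ℝ, ℂ).prod 𝓘(ℝ, ℂ)) (𝓘(ℝ, ℂ).prod 𝓘(ℝ, ℂ)) ∞ γ ∧ γ a = b ∧
        ∀ x, InoueSurface.mk D (γ x) = InoueSurface.mk D x := by
  let ψ := sol4EquivUpperHalf D
  obtain ⟨p, rfl⟩ := ψ.surjective a
  obtain ⟨q, rfl⟩ := ψ.surjective b
  obtain ⟨γ, hγ, rfl⟩ := (InoueSurface.mk_eq_iff D q p).1 h.symm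
  refine ⟨fun x => ψ (γ * ψ.symm x), ?_, by simp, fun x => ?_⟩
  · refine ((contMDiff_sol4EquivUpperHalf D).comp
      ((contDiff_left_mul_Sol4 D γ).contMDiff.comp
        (contMDiff_sol4EquivUpperHalf_symm D))).congr fun x => ?_
    simp [ψ]
  · obtain ⟨p, rfl⟩ := ψ.surjective x
    exact (InoueSurface.mk_eq_iff D _ _).2 ⟨γ, hγ, by simp⟩

/-- The bijection between `M⁴` and the Inoue surface. -/
noncomputable def M4EquivInoueSurface : M4 D ≃ InoueSurface D :=
  Quotient.congr (sol4EquivUpperHalf D) fun p q =>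
    ((MulAction.orbitRel_apply (G := Gamma4 D)).trans
      ⟨fun ⟨γ, h⟩ => ⟨γ, γ.2, h⟩, fun ⟨γ, hγ, h⟩ => ⟨⟨γ, hγ⟩, h⟩⟩).trans <|
    (InoueSurface.mk_eq_iff D p q).symm.trans
      (Quotient.eq'' (s₁ := MulAction.orbitRel (inoueGroup D) (ℍ × ℂ)))

theorem M4EquivInoueSurface_mk (p : Sol4 D) :
    M4EquivInoueSurface D (M4.mk D p) = InoueSurface.mk D (sol4ToUpperHalf D p) := rfl

theorem exists_diffeomorph_M4_InoueSurface [ChartedSpace (ℝ × ℝ × ℂ) (M4 D)]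
    [ChartedSpace (ModelProd ℂ ℂ) (InoueSurface D)]
    (h4 : IsLocalDiffeomorph 𝓘(ℝ, ℝ × ℝ × ℂ) 𝓘(ℝ, ℝ × ℝ × ℂ) ∞ (M4.proj D))
    (hS : IsLocalDiffeomorph (𝓘(ℝ, ℂ).prod 𝓘(ℝ, ℂ)) (𝓘(ℝ, ℂ).prod 𝓘(ℝ, ℂ)) ∞
      (InoueSurface.mk D)) :
    ∃ Φ : M4 D ≃ₘ⟮𝓘(ℝ, ℝ × ℝ × ℂ), 𝓘(ℝ, ℂ).prod 𝓘(ℝ, ℂ)⟯ InoueSurface D,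
      ∀ p : Sol4 D, Φ (M4.mk D p) = InoueSurface.mk D (sol4ToUpperHalf D p) := by
  refine ⟨{ toEquiv := M4EquivInoueSurface D
            contMDiff_toFun := ?_
            contMDiff_invFun := ?_ }, M4EquivInoueSurface_mk D⟩
  · exact h4.contMDiff_of_comp (surjective_M4_proj D)
      (hS.contMDiff.comp (contMDiff_sol4EquivUpperHalf D))
  · refine hS.contMDiff_of_comp (surjective_InoueSurface_mk D)
      ((h4.contMDiff.comp (contMDiff_sol4EquivUpperHalf_symm D)).congr fun x => ?_)
    obtain ⟨p, rfl⟩ := (sol4EquivUpperHalf D).surjective x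
    change (M4EquivInoueSurface D).symm (InoueSurface.mk D (sol4ToUpperHalf D p)) = M4.mk D _
    rw [Equiv.symm_apply_eq]
    simp [M4EquivInoueSurface_mk]

end UpperHalfPlane

/-! ### Local angle coordinates on the circle -/

section CircleCoordinate

open Filter Topology

/-- The covering `r ↦ e ^ (2 π i r)` of the circle. -/
noncomputable def circleCover (r : ℝ) : Circle := Circle.exp (2 * Real.pi * r)

theorem contMDiff_circleCover : ContMDiff 𝓘(ℝ, ℝ) (𝓡 1) ∞ circleCover := by
  have h : ContDiff ℝ ∞ fun r : ℝ => 2 * Real.pi * r := by fun_prop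
  exact contMDiff_circleExp.comp h.contMDiff

theorem circleCover_eq_iff (r s : ℝ) : circleCover r = circleCover s ↔ ∃ n : ℤ, r = s + n := by
  have h : 2 * Real.pi ≠ 0 := Real.two_pi_pos.ne'
  rw [circleCover, circleCover, Circle.exp_eq_exp]
  refine exists_congr fun n => ?_
  rw [mul_comm (n : ℝ), ← mul_add, mul_right_inj' h]

/-- A section of `circleCover` that is smooth near `θ₀`. -/
noncomputable def circleSection (θ₀ θ : Circle) : ℝ :=
  ((Complex.log ((θ : ℂ) * (θ₀⁻¹ : Circle))).im + Complex.arg θ₀) / (2 * Real.pi)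

theorem circleCover_circleSection (θ₀ θ : Circle) : circleCover (circleSection θ₀ θ) = θ := by
  rw [circleCover, circleSection, mul_div_cancel₀ _ Real.two_pi_pos.ne', Complex.log_im,
    ← Circle.coe_mul, Circle.exp_add, Circle.exp_arg, Circle.exp_arg, inv_mul_cancel_right]

/-- Division by `θ₀` moves the base point to `1`, away from the cut of the logarithm. -/
theorem contMDiffAt_circleSection (θ₀ : Circle) :
    ContMDiffAt (𝓡 1) 𝓘(ℝ, ℝ) ∞ (circleSection θ₀) θ₀ := by
  have hcoe : ContMDiff (𝓡 1) 𝓘(ℝ, ℂ) ∞ fun θ : Circle => (θ : ℂ) :=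
    haveI := finrank_real_complex_fact'
    contMDiff_coe_sphere (E := ℂ) (n := 1)
  have h : ContDiffAt ℝ ∞ (fun w : ℂ =>
      (Complex.imCLM (Complex.log (w * (θ₀⁻¹ : Circle))) + Complex.arg θ₀) / (2 * Real.pi)) θ₀ := by
    have h1 : (θ₀ : ℂ) * (θ₀⁻¹ : Circle) = 1 := by
      rw [← Circle.coe_mul, mul_inv_cancel, Circle.coe_one]
    have h2 : ContDiffAt ℝ ∞ Complex.log ((θ₀ : ℂ) * (θ₀⁻¹ : Circle)) := by
      rw [h1]
      exact (Complex.contDiffAt_log Complex.one_mem_slitPlane).restrict_scalars ℝ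
    have h3 : ContDiffAt ℝ ∞ (fun w : ℂ => w * (θ₀⁻¹ : Circle)) θ₀ := by fun_prop
    have h4 : ContDiffAt ℝ ∞ (fun w : ℂ => Complex.log (w * (θ₀⁻¹ : Circle))) (θ₀ : ℂ) :=
      ContDiffAt.comp (θ₀ : ℂ) (g := Complex.log) (f := fun w : ℂ => w * (θ₀⁻¹ : Circle)) h2 h3
    have h5 : ContDiffAt ℝ ∞ (fun w : ℂ => Complex.imCLM (Complex.log (w * (θ₀⁻¹ : Circle))))
        (θ₀ : ℂ) := Complex.imCLM.contDiff.contDiffAt.comp (θ₀ : ℂ) h4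
    exact (h5.add contDiffAt_const).div_const _
  exact h.contMDiffAt.comp θ₀ (hcoe θ₀)

end CircleCoordinate

/-! ### The torus bundle `M⁶ → M⁴` -/

section TorusBundle

open Filter Topology

variable (D : InoueData)

/-- Insert a fibre coordinate. -/
def insertW (x : (ℝ × ℝ × ℂ) × ℂ) : ℝ × ℝ × ℂ × ℂ := (x.1.1, x.1.2.1, x.1.2.2, x.2)

theorem contDiff_insertW : ContDiff ℝ ∞ insertW := by
  unfold insertW
  fun_prop

/-- The point of the torus with coordinate `w` modulo the Gaussian integers. -/
noncomputable def torusPoint (w : ℂ) : Circle × Circle := (circleCover w.re, circleCover w.im)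

theorem contMDiff_torusPoint : ContMDiff 𝓘(ℝ, ℂ) ((𝓡 1).prod (𝓡 1)) ∞ torusPoint :=
  (contMDiff_circleCover.comp Complex.reCLM.contDiff.contMDiff).prodMk
    (contMDiff_circleCover.comp Complex.imCLM.contDiff.contMDiff)

theorem torusPoint_eq_iff (w w' : ℂ) :
    torusPoint w = torusPoint w' ↔ w - w' ∈ gaussianSubring := by
  simp only [torusPoint, Prod.mk.injEq, circleCover_eq_iff, mem_gaussianSubring]
  constructor
  · rintro ⟨⟨a, ha⟩, b, hb⟩
    exact ⟨a, b, Complex.ext (by simp [ha]) (by simp [hb])⟩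
  · rintro ⟨a, b, h⟩
    rw [sub_eq_iff_eq_add'] at h
    exact ⟨⟨a, by simp [h]⟩, b, by simp [h]⟩

/-- A section of `torusPoint` that is smooth near `θ₀`. -/
noncomputable def torusSection (θ₀ θ : Circle × Circle) : ℂ :=
  circleSection θ₀.1 θ.1 + circleSection θ₀.2 θ.2 * Complex.I

theorem torusPoint_torusSection (θ₀ θ : Circle × Circle) :
    torusPoint (torusSection θ₀ θ) = θ :=
  Prod.ext (by simp [torusPoint, torusSection, circleCover_circleSection])
    (by simp [torusPoint, torusSection, circleCover_circleSection])

theorem contMDiffAt_torusSection (θ₀ : Circle × Circle) :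
    ContMDiffAt ((𝓡 1).prod (𝓡 1)) 𝓘(ℝ, ℂ) ∞ (torusSection θ₀) θ₀ := by
  have h1 : ContMDiffAt ((𝓡 1).prod (𝓡 1)) 𝓘(ℝ, ℝ) ∞
      (fun θ : Circle × Circle => circleSection θ₀.1 θ.1) θ₀ :=
    (contMDiffAt_circleSection θ₀.1).comp θ₀ contMDiffAt_fst
  have h2 : ContMDiffAt ((𝓡 1).prod (𝓡 1)) 𝓘(ℝ, ℝ) ∞
      (fun θ : Circle × Circle => circleSection θ₀.2 θ.2) θ₀ :=
    (contMDiffAt_circleSection θ₀.2).comp θ₀ contMDiffAt_snd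
  have h : ContDiff ℝ ∞ fun x : ℝ × ℝ =>
      Complex.ofRealCLM x.1 + Complex.ofRealCLM x.2 * Complex.I := by fun_prop
  exact h.contMDiff.contMDiffAt.comp θ₀ (h1.prodMk_space h2)

/-- An element of `Γ` relating two points with equal `t` has time `0`, so it does not rotate `w` but
shifts it by a Gaussian integer; all such shifts lie in `Γ`. -/
theorem M6.proj_insertW_eq_iff (a : ℝ × ℝ × ℂ) (w w' : ℂ) :
    M6.proj D (insertW (a, w)) = M6.proj D (insertW (a, w')) ↔ torusPoint w = torusPoint w' := by
  rw [torusPoint_eq_iff]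
  refine (M6.mk_eq_iff D _ _).trans ⟨?_, fun h => ⟨_, fiberTranslation_mem D h, ?_⟩⟩
  · rintro ⟨γ, hγ, h⟩
    obtain ⟨-, -, -, -, hw⟩ := exists_of_mem_Gamma6 D hγ
    have ht : γ.t + a.1 = a.1 := congrArg Sol6.t h
    have ht0 : γ.t = 0 := by simpa using ht
    have hw' : quarterRotation γ.t * w' + γ.w = w := congrArg Sol6.w h
    rw [ht0, quarterRotation_zero, one_mul] at hw'
    rwa [← hw', add_sub_cancel_left]
  · ext <;> simp [Sol6.mul_def, insertW, Sol6.coords, quarterRotation_zero]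

theorem exists_proj_insertW {x : M6 D} {a : ℝ × ℝ × ℂ} (h : forgetW D x = M4.proj D a) :
    ∃ w, M6.proj D (insertW (a, w)) = x := by
  obtain ⟨b, rfl⟩ := surjective_M6_proj D x
  obtain ⟨γ, hγ, hγa⟩ := (M4.proj_eq_iff D a (b.1, b.2.1, b.2.2.1)).1 h.symm
  refine ⟨quarterRotation γ.t * b.2.2.2, (M6.mk_eq_iff D _ _).2
    ⟨zeroSection D γ, zeroSection_mem D hγ, ?_⟩⟩
  rw [← hγa]
  ext <;> simp [Sol6.mul_def, Sol4.mul_def, insertW, Sol6.coords, Sol4.coords, zeroSection]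

/-- A fibre coordinate of a point of `M⁶` over a given point of the coordinate space. -/
noncomputable def fiberCoordinate (a : ℝ × ℝ × ℂ) (x : M6 D) : ℂ :=
  Classical.epsilon fun w => M6.proj D (insertW (a, w)) = x

/-- The chosen fibre coordinate is arbitrary, but its ambiguity is a Gaussian integer and disappears
in the torus. -/
theorem torusPoint_fiberCoordinate (a : ℝ × ℝ × ℂ) (w : ℂ) :
    torusPoint (fiberCoordinate D a (M6.proj D (insertW (a, w)))) = torusPoint w :=
  (M6.proj_insertW_eq_iff D a _ _).1 (Classical.epsilon_spec
    (p := fun w' => M6.proj D (insertW (a, w')) = M6.proj D (insertW (a, w))) ⟨w, rfl⟩)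

theorem isSmoothFiberBundle_forgetW [ChartedSpace (ℝ × ℝ × ℂ × ℂ) (M6 D)]
    [ChartedSpace (ℝ × ℝ × ℂ) (M4 D)]
    (h6 : IsLocalDiffeomorph 𝓘(ℝ, ℝ × ℝ × ℂ × ℂ) 𝓘(ℝ, ℝ × ℝ × ℂ × ℂ) ∞ (M6.proj D))
    (h4 : IsLocalDiffeomorph 𝓘(ℝ, ℝ × ℝ × ℂ) 𝓘(ℝ, ℝ × ℝ × ℂ) ∞ (M4.proj D)) :
    IsSmoothFiberBundle 𝓘(ℝ, ℝ × ℝ × ℂ × ℂ) 𝓘(ℝ, ℝ × ℝ × ℂ) ((𝓡 1).prod (𝓡 1))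
      (Circle × Circle) (forgetW D) := by
  intro b
  obtain ⟨x₀, rfl⟩ := surjective_M4_proj D b
  have hf := h4.isLocalHomeomorph
  let g := hf.localInverseAt x₀
  have hpg : ∀ y ∈ g.source, M4.proj D (g y) = y := fun y hy => hf.apply_localInverseAt_of_mem hy
  have hgp : ∀ a ∈ g.target, g (M4.proj D a) = a := fun a ha => by
    have := g.right_inv ha
    rwa [hf.localInverseAt_symm] at this
  -- Upstairs `g ∘ M4.proj D` is locally the identity, so `g` is smooth by descent.
  have hg : ContMDiffOn 𝓘(ℝ, ℝ × ℝ × ℂ) 𝓘(ℝ, ℝ × ℝ × ℂ) ∞ g g.source := fun y hy => by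
    have h := (h4 (g y)).contMDiffAt_of_comp (F := g) (contMDiffAt_id.congr_of_eventuallyEq
      (by filter_upwards [g.open_target.mem_nhds (g.map_source hy)] with a ha using hgp a ha))
    rw [hpg y hy] at h
    exact h.contMDiffWithinAt
  let toF : M6 D → M4 D × (Circle × Circle) := fun x =>
    (forgetW D x, torusPoint (fiberCoordinate D (g (forgetW D x)) x))
  let invF : M4 D × (Circle × Circle) → M6 D := fun y =>
    M6.proj D (insertW (g y.1, torusSection 1 y.2))
  have toF_apply : ∀ a ∈ g.target, ∀ w, toF (M6.proj D (insertW (a, w))) =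
      (M4.proj D a, torusPoint w) := fun a ha w => by
    refine Prod.ext rfl ?_
    change torusPoint (fiberCoordinate D (g (M4.proj D a)) _) = _
    rw [hgp a ha, torusPoint_fiberCoordinate]
  -- The fixed section `torusSection 1` need not be continuous everywhere, but any preimage of `θ`
  -- gives the same point. Near a given `θ` the section centred there can be used instead, which
  -- proves smoothness.
  have invF_apply : ∀ y θ w, torusPoint w = θ →
      invF (y, θ) = M6.proj D (insertW (g y, w)) := fun y θ w hw =>
    (M6.proj_insertW_eq_iff D _ _ _).2 ((torusPoint_torusSection 1 θ).trans hw.symm)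
  have hrep : ∀ x ∈ forgetW D ⁻¹' g.source, ∃ w, M6.proj D (insertW (g (forgetW D x), w)) = x :=
    fun x hx => exists_proj_insertW D (hpg _ hx).symm
  have toF_smooth : ContMDiffOn 𝓘(ℝ, ℝ × ℝ × ℂ × ℂ)
      (𝓘(ℝ, ℝ × ℝ × ℂ).prod ((𝓡 1).prod (𝓡 1))) ∞ toF (forgetW D ⁻¹' g.source) := by
    intro x hx
    obtain ⟨w, hw⟩ := hrep x hx
    set a := g (forgetW D x)
    have ha : a ∈ g.target := g.map_source hx
    rw [← hw]
    -- Smoothness is checked in the coordinate space, where the trivialization is `M4.proj` on `(t,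
    -- u, z)` and `torusPoint` on `w`.
    refine (IsLocalDiffeomorphAt.contMDiffAt_of_comp (h6 (insertW (a, w))) ?_).contMDiffWithinAt
    have hfst : ContDiff ℝ ∞ fun x : ℝ × ℝ × ℂ × ℂ => (x.1, x.2.1, x.2.2.1) := by fun_prop
    have hsnd : ContDiff ℝ ∞ fun x : ℝ × ℝ × ℂ × ℂ => x.2.2.2 := by fun_prop
    have hs : ContMDiff 𝓘(ℝ, ℝ × ℝ × ℂ × ℂ) (𝓘(ℝ, ℝ × ℝ × ℂ).prod ((𝓡 1).prod (𝓡 1))) ∞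
        fun x : ℝ × ℝ × ℂ × ℂ => (M4.proj D (x.1, x.2.1, x.2.2.1), torusPoint x.2.2.2) :=
      (h4.contMDiff.comp hfst.contMDiff).prodMk (contMDiff_torusPoint.comp hsnd.contMDiff)
    refine (hs _).congr_of_eventuallyEq ?_
    filter_upwards [hfst.continuous.continuousAt.preimage_mem_nhds
      (g.open_target.mem_nhds ha)] with x hx
    exact toF_apply (x.1, x.2.1, x.2.2.1) hx x.2.2.2
  have invF_smooth : ContMDiffOn (𝓘(ℝ, ℝ × ℝ × ℂ).prod ((𝓡 1).prod (𝓡 1)))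
      𝓘(ℝ, ℝ × ℝ × ℂ × ℂ) ∞ invF (g.source ×ˢ Set.univ) := by
    rintro ⟨y, θ⟩ ⟨hy, -⟩
    have h1 : ContMDiffAt (𝓘(ℝ, ℝ × ℝ × ℂ).prod ((𝓡 1).prod (𝓡 1))) 𝓘(ℝ, ℝ × ℝ × ℂ) ∞
        (fun x : M4 D × (Circle × Circle) => g x.1) (y, θ) :=
      (hg.contMDiffAt (g.open_source.mem_nhds hy)).comp (y, θ) contMDiffAt_fst
    have h2 : ContMDiffAt (𝓘(ℝ, ℝ × ℝ × ℂ).prod ((𝓡 1).prod (𝓡 1))) 𝓘(ℝ, ℂ) ∞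
        (fun x : M4 D × (Circle × Circle) => torusSection θ x.2) (y, θ) :=
      (contMDiffAt_torusSection θ).comp (y, θ) contMDiffAt_snd
    have h3 := (h6.contMDiff.comp contDiff_insertW.contMDiff).contMDiffAt.comp (y, θ)
      (h1.prodMk_space h2)
    refine (h3.congr_of_eventuallyEq (Filter.Eventually.of_forall ?_)).contMDiffWithinAt
    rintro ⟨y', θ'⟩
    exact invF_apply y' θ' _ (torusPoint_torusSection θ θ')
  let e : Bundle.Trivialization (Circle × Circle) (forgetW D) :=
    { toFun := toF
      invFun := invF
      source := forgetW D ⁻¹' g.source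
      target := g.source ×ˢ Set.univ
      map_source' := fun x hx => ⟨hx, trivial⟩
      map_target' := fun y hy => by
        change M4.proj D (g y.1) ∈ g.source
        rw [hpg _ hy.1]
        exact hy.1
      left_inv' := fun x hx => by
        obtain ⟨w, hw⟩ := hrep x hx
        have h := toF_apply _ (g.map_source hx) w
        rw [hw] at h
        rw [h, invF_apply _ _ w rfl, hpg _ hx, hw]
      right_inv' := fun y hy => by
        have h := toF_apply _ (g.map_source hy.1) (torusSection 1 y.2)
        rw [hpg _ hy.1, torusPoint_torusSection] at h
        exact h
      open_source := g.open_source.preimage (continuous_forgetW D)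
      open_target := g.open_source.prod isOpen_univ
      continuousOn_toFun := toF_smooth.continuousOn
      continuousOn_invFun := invF_smooth.continuousOn
      baseSet := g.source
      open_baseSet := g.open_source
      source_eq := rfl
      target_eq := rfl
      proj_toFun := fun x _ => rfl }
  exact ⟨e, hf.apply_self_mem_localInverseAt_source, toF_smooth, invF_smooth⟩

end TorusBundle

/-- The charted space structures below are the quotient smooth structures: they are pinned down by
the requirement that the quotient maps be local diffeomorphisms. -/
theorem proposition3p2 (D : InoueData) :
    (∃ (_ : ChartedSpace (ℝ × ℝ × ℂ × ℂ) (M6 D)) (_ : ChartedSpace (ℝ × ℝ × ℂ) (M4 D))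
        (_ : ChartedSpace (ModelProd ℂ ℂ) (InoueSurface D)),
      -- `M⁶` is a compact smooth manifold, with its smooth structure as a quotient
      (CompactSpace (M6 D) ∧ T2Space (M6 D) ∧
        IsManifold 𝓘(ℝ, ℝ × ℝ × ℂ × ℂ) ∞ (M6 D) ∧
        IsLocalDiffeomorph 𝓘(ℝ, ℝ × ℝ × ℂ × ℂ) 𝓘(ℝ, ℝ × ℝ × ℂ × ℂ) ∞ (M6.proj D)) ∧
      -- so is `M⁴`
      (CompactSpace (M4 D) ∧ T2Space (M4 D) ∧
        IsManifold 𝓘(ℝ, ℝ × ℝ × ℂ) ∞ (M4 D) ∧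
        IsLocalDiffeomorph 𝓘(ℝ, ℝ × ℝ × ℂ) 𝓘(ℝ, ℝ × ℝ × ℂ) ∞ (M4.proj D)) ∧
      -- so is the Inoue surface, as a quotient of `ℍ × ℂ`
      (IsManifold (𝓘(ℝ, ℂ).prod 𝓘(ℝ, ℂ)) ∞ (InoueSurface D) ∧
        IsLocalDiffeomorph (𝓘(ℝ, ℂ).prod 𝓘(ℝ, ℂ)) (𝓘(ℝ, ℂ).prod 𝓘(ℝ, ℂ)) ∞
          (InoueSurface.mk D)) ∧
      -- `M⁴` is the Inoue surface, through `(t, u, z) ↦ (u + i c ^ t, z)`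
      (∃ Φ : M4 D ≃ₘ⟮𝓘(ℝ, ℝ × ℝ × ℂ), 𝓘(ℝ, ℂ).prod 𝓘(ℝ, ℂ)⟯ InoueSurface D,
        ∀ p : Sol4 D, Φ (M4.mk D p) = InoueSurface.mk D (sol4ToUpperHalf D p)) ∧
      -- forgetting `w` makes `M⁶` the total space of a `T²`-bundle over it
      IsSmoothFiberBundle 𝓘(ℝ, ℝ × ℝ × ℂ × ℂ) 𝓘(ℝ, ℝ × ℝ × ℂ) ((𝓡 1).prod (𝓡 1))
        (Circle × Circle) (forgetW D)) ∧
    firstBettiNumber (M6 D) = 1 ∧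
    Module.finrank ℤ (Additive (Abelianization (Gamma6 D))) = 1 ∧
    ⁅g0 D, g4 D⁆ = (g4 D)⁻¹ * g5 D ∧
    ⁅g0 D, g5 D⁆ = (g4 D)⁻¹ * (g5 D)⁻¹ := by
  have l6 := (isCoveringMap_M6_proj D).isLocalHomeomorph
  have l4 := (isCoveringMap_M4_proj D).isLocalHomeomorph
  have lS := (isCoveringMap_InoueSurface_mk D).isLocalHomeomorph
  let c6 : ChartedSpace (ℝ × ℝ × ℂ × ℂ) (M6 D) := l6.chartedSpace (surjective_M6_proj D)
  let c4 : ChartedSpace (ℝ × ℝ × ℂ) (M4 D) := l4.chartedSpace (surjective_M4_proj D)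
  let cS : ChartedSpace (ModelProd ℂ ℂ) (InoueSurface D) :=
    lS.chartedSpace (surjective_InoueSurface_mk D)
  have d6 := l6.isLocalDiffeomorph_chartedSpace (surjective_M6_proj D) (M6.exists_deck D)
  have d4 := l4.isLocalDiffeomorph_chartedSpace (surjective_M4_proj D) (M4.exists_deck D)
  have dS := lS.isLocalDiffeomorph_chartedSpace (surjective_InoueSurface_mk D)
    (InoueSurface.exists_deck D)
  exact ⟨⟨c6, c4, cS,
    ⟨compactSpace_M6 D, t2Space_M6 D,
      l6.isManifold_chartedSpace (surjective_M6_proj D) (M6.exists_deck D), d6⟩,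
    ⟨compactSpace_M4 D, t2Space_M4 D,
      l4.isManifold_chartedSpace (surjective_M4_proj D) (M4.exists_deck D), d4⟩,
    ⟨lS.isManifold_chartedSpace (surjective_InoueSurface_mk D) (InoueSurface.exists_deck D), dS⟩,
    exists_diffeomorph_M4_InoueSurface D d4 dS, isSmoothFiberBundle_forgetW D d6 d4⟩,
    firstBettiNumber_M6 D, finrank_abelianization_Gamma6 D, commutator_g0_g4 D,
    commutator_g0_g5 D⟩
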